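/- Let $\Bbbk$ be an algebraically closed field. All categories are finite abelian $\Bbbk$-linear categories. Let $\mathcal V$ be a braided finite tensor category, let $\mathcal C$ be a finite tensor category, and let $G:\mathcal V\to\mathcal Z(\mathcal C)$ be a faithful, $\Bbbk$-linear, right exact braided monoidal functor to the Drinfeld center; write $\sigma_{Z,X}:Z\otimes X\to X\otimes Z$ for the half-braiding of $Z\in\mathcal Z(\mathcal C)$. Let $\mathcal Z^{\mathcal V}(\mathcal C)$ be the relative center, i.e. the full subcategory of those $Z\in\mathcal Z(\mathcal C)$ with $\sigma_{G(V),Z}\,\sigma_{Z,G(V)}=\mathrm{id}$ for all $V\in\mathcal V$. Let $\mathcal M$ be a left $\mathcal C$-module category, with action $\triangleright$ ($\Bbbk$-bilinear and exact in each variable) and associativity $m_{X,Y,M}:(X\otimes Y)\triangleright M\to X\triangleright(Y\triangleright M)$, and let $\mathcal V$ act on $\mathcal M$ by $V\blacktriangleright M=G(V)\triangleright M$. The internal Homs $\underline{\mathrm{Hom}}(M,N)\in\mathcal C$, with $\phi:\mathrm{Hom}_{\mathcal C}(X,\underline{\mathrm{Hom}}(M,N))\cong\mathrm{Hom}_{\mathcal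 M}(X\triangleright M,N)$, exist; write $\underline{\mathrm{ev}}_{M,N}=\phi(\mathrm{id})$. For $V\in\mathcal V$ let $\beta^V_{M,N}:\underline{\mathrm{Hom}}(M,V\blacktriangleright N)\to\underline{\mathrm{Hom}}(V^*\blacktriangleright M,N)$ be the morphism which, with $H=\underline{\mathrm{Hom}}(M,V\blacktriangleright N)$, corresponds under $\phi$ to the composite $$H\triangleright (V^*\blacktriangleright M)\xrightarrow{\ \sigma_{G(V^*),H}^{-1}\ }V^*\blacktriangleright(H\triangleright M)\xrightarrow{\ V^*\blacktriangleright\underline{\mathrm{ev}}\ }V^*\blacktriangleright(V\blacktriangleright N)\xrightarrow{\ \mathrm{ev}_V\ }N .$$ The relative end $A_{\mathcal V,\mathcal M}=\oint_{M\in\mathcal M}(\underline{\mathrm{Hom}}(M,M),\beta)$ exists; that is, there is a universal object $A=A_{\mathcal V,\mathcal M}$ of $\mathcal C$ with a dinatural family $\pi_M:A\to\underline{\mathrm{Hom}}(M,M)$ such that $$\underline{\mathrm{Hom}}(\mathrm{ev}_V\blacktriangleright\mathrm{id}_M,M)\,\pi_M=\underline{\mathrm{Hom}}(m_{V^*,V,M},M)\,\beta^V_{V\blacktriangleright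 M,M}\,\pi_{V\blacktriangleright M}\qquad (V\in\mathcal V,\ M\in\mathcal M).$$ Put $e_M=\underline{\mathrm{ev}}_{M,M}(\pi_M\triangleright\mathrm{id}_M):A\triangleright M\to M$. There is exactly one half-braiding $\sigma$ on $A$ with $\mathfrak a^{-1}_{X,M,M}(\mathrm{id}_X\otimes\pi_M)\sigma_X=\mathfrak b_{X,M,X\triangleright M}(\pi_{X\triangleright M}\otimes\mathrm{id}_X)$ for all $X,M$, where $\mathfrak a^{-1}_{X,M,N}:X\otimes\underline{\mathrm{Hom}}(M,N)\to\underline{\mathrm{Hom}}(M,X\triangleright N)$ and $\mathfrak b_{X,M,N}:\underline{\mathrm{Hom}}(X\triangleright M,N)\otimes X\to\underline{\mathrm{Hom}}(M,N)$ are the canonical morphisms induced by evaluation. $A$ is always equipped with this half-braiding. **Proposition.** $A_{\mathcal V,\mathcal M}$ lies in $\mathcal Z^{\mathcal V}(\mathcal C)$, and the pair $(A_{\mathcal V,\mathcal M},e)$ is a terminal object of the category of pairs $((Z,\sigma^Z),z)$, where $(Z,\sigma^Z)\in\mathcal Z^{\mathcal V}(\mathcal C)$ and $z_M:Z\triangleright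 M\to M$ is a natural transformation such that, for all $X\in\mathcal C$, $M\in\mathcal M$, $$z_{X\triangleright M}\; m_{Z,X,M}=(\mathrm{id}_X\triangleright z_M)\; m_{X,Z,M}\,(\sigma^Z_X\triangleright\mathrm{id}_M);$$ a morphism $(Z,z)\to(Z',z')$ is a morphism $f:Z\to Z'$ in $\mathcal Z(\mathcal C)$ with $z'_M(f\triangleright\mathrm{id}_M)=z_M$ for all $M$. Hence $A_{\mathcal V,\mathcal M}$ coincides with the braided commutative algebra of Laugwitz and Walton. That is: there is exactly one algebra structure on $A$ in $\mathcal Z(\mathcal C)$ for which each $\pi_M$ is multiplicative and unital with respect to the composition and the unit of the internal endomorphism object $\underline{\mathrm{Hom}}(M,M)$; it is commutative, and with it $e$ makes every $M$ an $A$-module. If $B$ is an algebra in $\mathcal C$ and $\mathcal M$ is equivalent, as a $\mathcal C$-module category, to the category of right $B$-modules in $\mathcal C$, then there is an algebra morphism $\zeta:A\to B$ in $\mathcal C$ such that $(A,\zeta)$ is terminal among the pairs $((Z,\sigma^Z),\zeta_Z)$, where $(Z,\sigma^Z)\in\mathcal Z^{\mathcal V}(\mathcal C)$ and $\zeta_Z:Z\to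 B$ satisfies $m_B(\zeta_Z\otimes\mathrm{id}_B)=m_B(\mathrm{id}_B\otimes\zeta_Z)\sigma^Z_B$; and every algebra $L$ in $\mathcal Z(\mathcal C)$ with an algebra morphism $L\to B$ in $\mathcal C$ making it a terminal such pair is isomorphic to $A$, as an algebra in $\mathcal Z(\mathcal C)$ over $B$. -/

import Mathlib

open CategoryTheory MonoidalCategory MonoidalLeftAction
open Functor.LaxMonoidal Functor.OplaxMonoidal

noncomputable section

namespace RelCenter

/-! ### Finite tensor categories and their module categories -/

/-- A `k`-linear abelian category is *finite*: finite-dimensional morphism spaces, objects of finite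
length, enough projectives, and finitely many simple objects up to isomorphism. -/
class IsFiniteLinear (k : Type*) [Field k] (D : Type*) [Category* D] [Abelian D] [Linear k D] :
    Prop where
  finite_hom : ∀ X Y : D, Module.Finite k (X ⟶ Y)
  noetherian : ∀ X : D, IsNoetherianObject X
  artinian : ∀ X : D, IsArtinianObject X
  enoughProjectives : EnoughProjectives D
  finite_simples : ∃ (n : ℕ) (S : Fin n → D), ∀ X : D, Simple X → ∃ i, Nonempty (X ≅ S i)

/-- A finite tensor category over `k`: a finite `k`-linear abelian category with a bilinear rigid
monoidal structure (given by the other instance arguments) whose unit object is simple. -/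
class IsFiniteTensor (k : Type*) [Field k] (C : Type*) [Category* C] [Abelian C] [Linear k C]
    [MonoidalCategory C] [RigidCategory C] [MonoidalPreadditive C] [MonoidalLinear k C] :
    Prop extends IsFiniteLinear k C where
  simple_unit : Simple (𝟙_ C)

/-- A finite `k`-linear abelian category `M` with a left action of the monoidal category `C` is a
*`C`-module category* if the action bifunctor is `k`-bilinear and exact in each variable. -/
class IsModuleCategory (k : Type*) [Field k] (C : Type*) [Category* C] [Abelian C] [Linear k C]
    [MonoidalCategory C] (M : Type*) [Category* M] [Abelian M] [Linear k M]
    [MonoidalLeftAction C M] : Prop extends IsFiniteLinear k M where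
  additive_right : ∀ X : C, ((curriedAction C M).obj X).Additive
  linear_right : ∀ X : C, ((curriedAction C M).obj X).Linear k
  preservesFiniteLimits_right : ∀ X : C, Limits.PreservesFiniteLimits ((curriedAction C M).obj X)
  preservesFiniteColimits_right :
    ∀ X : C, Limits.PreservesFiniteColimits ((curriedAction C M).obj X)
  additive_left : ∀ m : M, ((curriedAction C M).flip.obj m).Additive
  linear_left : ∀ m : M, ((curriedAction C M).flip.obj m).Linear k
  preservesFiniteLimits_left :
    ∀ m : M, Limits.PreservesFiniteLimits ((curriedAction C M).flip.obj m)
  preservesFiniteColimits_left :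
    ∀ m : M, Limits.PreservesFiniteColimits ((curriedAction C M).flip.obj m)

/-! ### Internal Homs -/

section InternalHom

variable {C : Type*} [Category* C] [MonoidalCategory C]
  {M : Type*} [Category* M] [MonoidalLeftAction C M]

/-- An internal Hom from `m` to `n`: an object of `C` representing `X ↦ Hom_M (X ▷ m, n)`. -/
structure IHom (C : Type*) [Category* C] [MonoidalCategory C] {M : Type*} [Category* M]
    [MonoidalLeftAction C M] (m n : M) where
  obj : C
  φ : ∀ X : C, (X ⟶ obj) ≃ (X ⊙ₗ m ⟶ n)
  φ_comp : ∀ {X X' : C} (h : X' ⟶ X) (a : X ⟶ obj), φ X' (h ≫ a) = h ⊵ₗ m ≫ φ X a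

variable (H : ∀ m n : M, IHom C m n)

/-- The evaluation `Hom(m, n) ▷ m ⟶ n`. -/
def ihomEv (m n : M) : (H m n).obj ⊙ₗ m ⟶ n := (H m n).φ _ (𝟙 _)

/-- Covariant functoriality `Hom(m, f)` of the internal Hom. -/
def ihomMapRight (m : M) {n n' : M} (f : n ⟶ n') : (H m n).obj ⟶ (H m n').obj :=
  ((H m n').φ _).symm (ihomEv H m n ≫ f)

/-- Contravariant functoriality `Hom(g, n)` of the internal Hom. -/
def ihomMapLeft {m m' : M} (g : m' ⟶ m) (n : M) : (H m n).obj ⟶ (H m' n).obj :=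
  ((H m' n).φ _).symm ((H m n).obj ⊴ₗ g ≫ ihomEv H m n)

/-- The coevaluation at the unit object, `𝟙 ⟶ Hom(m, m)`. -/
def ihomUnit (m : M) : 𝟙_ C ⟶ (H m m).obj := ((H m m).φ _).symm (λₗ m).hom

/-- The composition `Hom(m₂, m₃) ⊗ Hom(m₁, m₂) ⟶ Hom(m₁, m₃)`. -/
def ihomComp (m₁ m₂ m₃ : M) : (H m₂ m₃).obj ⊗ (H m₁ m₂).obj ⟶ (H m₁ m₃).obj :=
  ((H m₁ m₃).φ _).symm
    ((αₗ _ _ _).hom ≫ (H m₂ m₃).obj ⊴ₗ ihomEv H m₁ m₂ ≫ ihomEv H m₂ m₃)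

/-- The canonical morphism `𝔞⁻¹ : X ⊗ Hom(m, n) ⟶ Hom(m, X ▷ n)`. -/
def ihomA (X : C) (m n : M) : X ⊗ (H m n).obj ⟶ (H m (X ⊙ₗ n)).obj :=
  ((H m (X ⊙ₗ n)).φ _).symm ((αₗ _ _ _).hom ≫ X ⊴ₗ ihomEv H m n)

/-- The canonical morphism `𝔟 : Hom(X ▷ m, n) ⊗ X ⟶ Hom(m, n)`. -/
def ihomB (X : C) (m n : M) : (H (X ⊙ₗ m) n).obj ⊗ X ⟶ (H m n).obj :=
  ((H m n).φ _).symm ((αₗ _ _ _).hom ≫ ihomEv H (X ⊙ₗ m) n)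

end InternalHom

/-! ### The relative end defining `A_{V,M}` -/

section RelativeEnd

variable {V : Type*} [Category* V] [MonoidalCategory V] [BraidedCategory V] [RigidCategory V]
  {C : Type*} [Category* C] [MonoidalCategory C]
  (G : V ⥤ Center C) [G.Braided]
  {M : Type*} [Category* M] [MonoidalLeftAction C M]

/-- The action `v ▶ m = G(v) ▷ m` of `V` on `M` through `G`. -/
abbrev vAct (v : V) (m : M) : M := (G.obj v).1 ⊙ₗ m

/-- The associativity isomorphism `(v ⊗ w) ▶ m ⟶ v ▶ (w ▶ m)` of this action. -/
def vAssoc (v w : V) (m : M) : vAct G (v ⊗ w) m ⟶ vAct G v (vAct G w m) :=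
  δ (G ⋙ Center.forget C) v w ⊵ₗ m ≫ (αₗ _ _ _).hom

/-- `ev_v ▶ m : (v* ⊗ v) ▶ m ⟶ m`, where `v*` is the dual with `ev : v* ⊗ v ⟶ 𝟙`. -/
def vEv (v : V) (m : M) : vAct G (vᘁ ⊗ v) m ⟶ m :=
  (G ⋙ Center.forget C).map (ε_ v vᘁ) ⊵ₗ m ≫ η (G ⋙ Center.forget C) ⊵ₗ m ≫ (λₗ m).hom

/-- The evaluation `G(v*) ⊗ G(v) ⟶ 𝟙`. -/
def evG (v : V) : (G.obj vᘁ).1 ⊗ (G.obj v).1 ⟶ 𝟙_ C :=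
  μ (G ⋙ Center.forget C) vᘁ v ≫ (G ⋙ Center.forget C).map (ε_ v vᘁ) ≫
    η (G ⋙ Center.forget C)

/-- The map `Hom(X ▷ m, v ▶ n) → Hom(X ▷ (v* ▶ m), n)` which moves `v` to the other side: tensor
with `v*`, evaluate, and pass `v*` across `X` with the inverse half-braiding of `G(v*)`. -/
def gammaMap (X : C) (v : V) (m n : M) (f : X ⊙ₗ m ⟶ vAct G v n) :
    X ⊙ₗ vAct G vᘁ m ⟶ n :=
  (αₗ X (G.obj vᘁ).1 m).inv ≫ ((G.obj vᘁ).2.β X).inv ⊵ₗ m ≫ (αₗ (G.obj vᘁ).1 X m).hom ≫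
    (G.obj vᘁ).1 ⊴ₗ f ≫ (αₗ (G.obj vᘁ).1 (G.obj v).1 n).inv ≫ evG G v ⊵ₗ n ≫ (λₗ n).hom

variable (H : ∀ m n : M, IHom C m n)

/-- The `V`-prebalancing `β : Hom(m, v ▶ n) ⟶ Hom(v* ▶ m, n)` of the internal Hom. -/
def beta (v : V) (m n : M) : (H m (vAct G v n)).obj ⟶ (H (vAct G vᘁ m) n).obj :=
  ((H (vAct G vᘁ m) n).φ _).symm (gammaMap G _ v m n (ihomEv H m (vAct G v n)))

/-- A family `ξ_m : E ⟶ Hom(m, m)` that is dinatural and compatible with the prebalancing. -/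
structure IsRelWedge {E : C} (ξ : ∀ m : M, E ⟶ (H m m).obj) : Prop where
  dinatural : ∀ {m n : M} (f : m ⟶ n),
    ξ m ≫ ihomMapRight H m f = ξ n ≫ ihomMapLeft H f n
  balanced : ∀ (v : V) (m : M),
    ξ m ≫ ihomMapLeft H (vEv G v m) m =
      ξ (vAct G v m) ≫ beta G H v (vAct G v m) m ≫ ihomMapLeft H (vAssoc G vᘁ v m) m

/-- A relative end of `(Hom(-, -), β)`, with its universal dinatural family `π`. -/
structure RelativeEnd where
  obj : C
  π : ∀ m : M, obj ⟶ (H m m).obj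
  isWedge : IsRelWedge G H π
  universal : ∀ {E : C} (ξ : ∀ m : M, E ⟶ (H m m).obj), IsRelWedge G H ξ →
    ∃! h : E ⟶ obj, ∀ m, h ≫ π m = ξ m

variable {G H}

/-- The natural family `e_m : A ▷ m ⟶ m`. -/
def RelativeEnd.e (A : RelativeEnd G H) (m : M) : A.obj ⊙ₗ m ⟶ m :=
  A.π m ⊵ₗ m ≫ ihomEv H m m

/-- The object of the center given by the relative end and a half-braiding. -/
abbrev RelativeEnd.center (A : RelativeEnd G H) (σ : HalfBraiding A.obj) : Center C := ⟨A.obj, σ⟩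

/-- The equation characterising the canonical half-braiding of the relative end:
`𝔞⁻¹ ∘ (X ⊗ π_m) ∘ σ_X = 𝔟 ∘ (π_{X ▷ m} ⊗ X)`. -/
def RelativeEnd.IsCanonicalHalfBraiding (A : RelativeEnd G H) (σ : HalfBraiding A.obj) : Prop :=
  ∀ (X : C) (m : M), (σ.β X).hom ≫ X ◁ A.π m ≫ ihomA H X m m =
    A.π (X ⊙ₗ m) ▷ X ≫ ihomB H X m (X ⊙ₗ m)

/-- The equations characterising the canonical algebra structure of the relative end: each `π_m` is
multiplicative for the composition of internal Homs, and unital. -/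
def RelativeEnd.IsCanonicalAlgebra (A : RelativeEnd G H) (σ : HalfBraiding A.obj)
    (mon : MonObj (A.center σ)) : Prop :=
  (∀ m : M, (mon.mul.f : A.obj ⊗ A.obj ⟶ A.obj) ≫ A.π m =
    (A.π m ⊗ₘ A.π m) ≫ ihomComp H m m m) ∧
  (∀ m : M, (mon.one.f : 𝟙_ C ⟶ A.obj) ≫ A.π m = ihomUnit H m)

end RelativeEnd

/-! ### The relative center and the category of pairs -/

section Pairs

variable {V : Type*} [Category* V] {C : Type*} [Category* C] [MonoidalCategory C]

/-- `Z` lies in the relative center, i.e. in the Müger centralizer of `G(V)` in the center. -/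
def IsRelCentral (G : V ⥤ Center C) (Z : Center C) : Prop :=
  ∀ v : V, (β_ Z (G.obj v)).hom ≫ (β_ (G.obj v) Z).hom = 𝟙 (Z ⊗ G.obj v)

/-- A pair `((Z, σ), z)`: `(Z, σ)` in the relative center, and `z_m : Z ▷ m ⟶ m` natural with
`z_{X ▷ m} = (X ▷ z_m) ∘ (σ_X ▷ m)` up to the associativity of the action. -/
structure ActingPair (G : V ⥤ Center C) (M : Type*) [Category* M] [MonoidalLeftAction C M] where
  Z : Center C
  central : IsRelCentral G Z
  z : ∀ m : M, Z.1 ⊙ₗ m ⟶ m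
  natural : ∀ {m n : M} (f : m ⟶ n), Z.1 ⊴ₗ f ≫ z n = z m ≫ f
  compat : ∀ (X : C) (m : M),
    (αₗ Z.1 X m).hom ≫ z (X ⊙ₗ m) =
      (Z.2.β X).hom ⊵ₗ m ≫ (αₗ X Z.1 m).hom ≫ X ⊴ₗ z m

/-- A morphism of pairs is a morphism `Z ⟶ Z'` in the center that is compatible with `z, z'`. -/
@[ext]
structure ActingPair.Hom {G : V ⥤ Center C} {M : Type*} [Category* M] [MonoidalLeftAction C M]
    (P Q : ActingPair G M) where
  hom : P.Z ⟶ Q.Z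
  comm : ∀ m : M, hom.f ⊵ₗ m ≫ Q.z m = P.z m

instance {G : V ⥤ Center C} {M : Type*} [Category* M] [MonoidalLeftAction C M] :
    Category (ActingPair G M) where
  Hom := ActingPair.Hom
  id P := ⟨𝟙 _, fun m => by simp⟩
  comp f g := ⟨f.hom ≫ g.hom, fun m => by
    rw [← f.comm, ← g.comm, Center.comp_f, comp_actionHomLeft, Category.assoc]⟩
  id_comp f := ActingPair.Hom.ext (Category.id_comp _)
  comp_id f := ActingPair.Hom.ext (Category.comp_id _)
  assoc f g h := ActingPair.Hom.ext (Category.assoc _ _ _)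

/-- For an algebra `B` in `C`: a pair `((Z, σ), ζ)` with `(Z, σ)` in the relative center and
`ζ : Z ⟶ B` such that `m ∘ (ζ ⊗ B) = m ∘ (B ⊗ ζ) ∘ σ_B`. -/
structure CentralizingPair (G : V ⥤ Center C) (B : C) [MonObj B] where
  Z : Center C
  central : IsRelCentral G Z
  ζ : Z.1 ⟶ B
  compat : ζ ▷ B ≫ MonObj.mul = (Z.2.β B).hom ≫ B ◁ ζ ≫ MonObj.mul

/-- A morphism of such pairs is a morphism `Z ⟶ Z'` in the center over `B`. -/
@[ext]
structure CentralizingPair.Hom {G : V ⥤ Center C} {B : C} [MonObj B]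
    (P Q : CentralizingPair G B) where
  hom : P.Z ⟶ Q.Z
  comm : hom.f ≫ Q.ζ = P.ζ

instance {G : V ⥤ Center C} {B : C} [MonObj B] : Category (CentralizingPair G B) where
  Hom := CentralizingPair.Hom
  id P := ⟨𝟙 _, by simp⟩
  comp f g := ⟨f.hom ≫ g.hom, by
    rw [← f.comm, ← g.comm, Center.comp_f, Category.assoc]⟩
  id_comp f := CentralizingPair.Hom.ext (Category.id_comp _)
  comp_id f := CentralizingPair.Hom.ext (Category.comp_id _)
  assoc f g h := CentralizingPair.Hom.ext (Category.assoc _ _ _)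

/-- The Laugwitz–Walton algebra of an algebra `B` in `C` (the relative version of Davydov's full
center): an algebra `Z` in the center, lying in the relative center, with an algebra morphism
`ζ : Z ⟶ B` in `C` such that `(Z, ζ)` is a terminal centralizing pair. -/
structure IsLaugwitzWalton (G : V ⥤ Center C) (B : C) [MonObj B] (Z : Center C) [mon : MonObj Z]
    (ζ : Z.1 ⟶ B) : Prop where
  terminal : ∃ (hZ : IsRelCentral G Z)
    (hζ : ζ ▷ B ≫ MonObj.mul = (Z.2.β B).hom ≫ B ◁ ζ ≫ MonObj.mul),
    Nonempty (Limits.IsTerminal (⟨Z, hZ, ζ, hζ⟩ : CentralizingPair G B))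
  map_mul : (mon.mul.f : Z.1 ⊗ Z.1 ⟶ Z.1) ≫ ζ = (ζ ⊗ₘ ζ) ≫ MonObj.mul
  map_one : (mon.one.f : 𝟙_ C ⟶ Z.1) ≫ ζ = MonObj.one

end Pairs

/-! ### The module category of right modules over an algebra -/

section RightModules

variable {C : Type*} [Category* C] [MonoidalCategory C]

/-- A right module over the algebra `B` in `C`. -/
structure RightMod (B : C) [MonObj B] where
  X : C
  act : X ⊗ B ⟶ X
  act_one : X ◁ MonObj.one ≫ act = (ρ_ X).hom
  act_mul : act ▷ B ≫ act = (α_ X B B).hom ≫ X ◁ MonObj.mul ≫ act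

/-- A morphism of right modules. -/
@[ext]
structure RightMod.Hom {B : C} [MonObj B] (P Q : RightMod B) where
  hom : P.X ⟶ Q.X
  comm : P.act ≫ hom = hom ▷ B ≫ Q.act

instance (B : C) [MonObj B] : Category (RightMod B) where
  Hom := RightMod.Hom
  id P := ⟨𝟙 _, by simp⟩
  comp f g := ⟨f.hom ≫ g.hom, by
    rw [← Category.assoc, f.comm, Category.assoc, g.comm, comp_whiskerRight, Category.assoc]⟩
  id_comp f := RightMod.Hom.ext (Category.id_comp _)
  comp_id f := RightMod.Hom.ext (Category.comp_id _)
  assoc f g h := RightMod.Hom.ext (Category.assoc _ _ _)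

namespace RightMod

variable {B : C} [MonObj B]

@[ext]
theorem hom_ext {P Q : RightMod B} (f g : P ⟶ Q) (h : f.hom = g.hom) : f = g :=
  RightMod.Hom.ext h

@[simp]
theorem id_hom (P : RightMod B) : Hom.hom (𝟙 P) = 𝟙 P.X := rfl

@[simp]
theorem comp_hom {P Q R : RightMod B} (f : P ⟶ Q) (g : Q ⟶ R) :
    (f ≫ g).hom = f.hom ≫ g.hom := rfl

/-- An isomorphism of right modules from an isomorphism of the underlying objects. -/
@[simps]
def isoMk {P Q : RightMod B} (i : P.X ≅ Q.X) (h : P.act ≫ i.hom = i.hom ▷ B ≫ Q.act) :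
    P ≅ Q where
  hom := ⟨i.hom, h⟩
  inv := ⟨i.inv, by
    rw [← cancel_mono i.hom, Category.assoc, i.inv_hom_id, Category.comp_id, Category.assoc, h,
      ← Category.assoc, ← comp_whiskerRight, i.inv_hom_id, id_whiskerRight, Category.id_comp]⟩

/-- `Y ⊗ P` with the right action of `B` on the factor `P`. -/
@[simps]
def tens (Y : C) (P : RightMod B) : RightMod B where
  X := Y ⊗ P.X
  act := (α_ _ _ _).hom ≫ Y ◁ P.act
  act_one := by
    have := P.act_one
    rw [tensor_whiskerLeft_assoc, Iso.inv_hom_id_assoc, ← MonoidalCategory.whiskerLeft_comp, this]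
    simp
  act_mul := by
    have h := congrArg (fun t => Y ◁ t) P.act_mul
    simp only [MonoidalCategory.whiskerLeft_comp] at h
    simp [h]

theorem tens_left {Y Y' X B : C} (f : Y ⟶ Y') (a : X ⊗ B ⟶ X) :
    ((α_ Y X B).hom ≫ Y ◁ a) ≫ f ▷ X = (f ▷ X) ▷ B ≫ (α_ Y' X B).hom ≫ Y' ◁ a := by
  simp [whisker_exchange]

theorem tens_right {X X' B : C} (Y : C) (a : X ⊗ B ⟶ X) (a' : X' ⊗ B ⟶ X') (g : X ⟶ X')
    (h : a ≫ g = g ▷ B ≫ a') :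
    ((α_ Y X B).hom ≫ Y ◁ a) ≫ Y ◁ g = (Y ◁ g) ▷ B ≫ (α_ Y X' B).hom ≫ Y ◁ a' := by
  simp [← MonoidalCategory.whiskerLeft_comp, h]

theorem tens_assoc {X B : C} (Y Y' : C) (a : X ⊗ B ⟶ X) :
    ((α_ (Y ⊗ Y') X B).hom ≫ (Y ⊗ Y') ◁ a) ≫ (α_ Y Y' X).hom =
      (α_ Y Y' X).hom ▷ B ≫ (α_ Y (Y' ⊗ X) B).hom ≫ Y ◁ ((α_ Y' X B).hom ≫ Y' ◁ a) := by
  simp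

theorem tens_unit {X B : C} (a : X ⊗ B ⟶ X) :
    ((α_ (𝟙_ C) X B).hom ≫ 𝟙_ C ◁ a) ≫ (λ_ X).hom = (λ_ X).hom ▷ B ≫ a := by
  simp

/-- The left action of `C` on right `B`-modules: `Y ▷ P = Y ⊗ P`, with the constraints of `C`. -/
instance leftActionStruct : MonoidalLeftActionStruct C (RightMod B) where
  actionObj Y P := tens Y P
  actionHomLeft f P := ⟨f ▷ P.X, tens_left f P.act⟩
  actionHomRight Y _ _ f := ⟨Y ◁ f.hom, tens_right Y _ _ f.hom f.comm⟩
  actionAssocIso Y Y' P := isoMk (α_ Y Y' P.X) (tens_assoc Y Y' P.act)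
  actionUnitIso P := isoMk (λ_ P.X) (tens_unit P.act)

instance leftAction : MonoidalLeftAction C (RightMod B) where
  actionHom_def f g := rfl
  actionHomRight_id Y P := hom_ext _ _ (MonoidalCategory.whiskerLeft_id Y P.X)
  id_actionHomLeft Y P := hom_ext _ _ (id_whiskerRight Y P.X)
  actionHom_comp {c c' c'' d d' d''} f₁ f₂ g₁ g₂ := hom_ext _ _ (by
    change (f₁ ≫ f₂) ▷ d.X ≫ c'' ◁ (g₁.hom ≫ g₂.hom) =
      (f₁ ▷ d.X ≫ c' ◁ g₁.hom) ≫ f₂ ▷ d'.X ≫ c'' ◁ g₂.hom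
    simp [whisker_exchange_assoc])
  actionAssocIso_hom_naturality {c₁ c₂ c₃ c₄ d₁ d₂} f g h := hom_ext _ _ (by
    change ((f ⊗ₘ g) ▷ d₁.X ≫ (c₂ ⊗ c₄) ◁ h.hom) ≫ (α_ c₂ c₄ d₂.X).hom =
      (α_ c₁ c₃ d₁.X).hom ≫ f ▷ (c₃ ⊗ d₁.X) ≫ c₂ ◁ (g ▷ d₁.X ≫ c₄ ◁ h.hom)
    simp [MonoidalCategory.tensorHom_def])
  actionUnitIso_hom_naturality {d d'} f := hom_ext _ _ (leftUnitor_naturality f.hom).symm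
  whiskerLeft_actionHomLeft c {c' c''} f d := hom_ext _ _ (by
    change (c ◁ f) ▷ d.X = (α_ c c' d.X).hom ≫ c ◁ f ▷ d.X ≫ (α_ c c'' d.X).inv
    simp)
  whiskerRight_actionHomLeft {c c'} c'' f d := hom_ext _ _ (by
    change (f ▷ c'') ▷ d.X = (α_ c c'' d.X).hom ≫ f ▷ (c'' ⊗ d.X) ≫ (α_ c' c'' d.X).inv
    simp)
  associator_actionHom c₁ c₂ c₃ d := hom_ext _ _ (pentagon c₁ c₂ c₃ d.X)
  leftUnitor_actionHom c d := hom_ext _ _ (by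
    change (λ_ c).hom ▷ d.X = (α_ (𝟙_ C) c d.X).hom ≫ (λ_ (c ⊗ d.X)).hom
    simp)
  rightUnitor_actionHom c d := hom_ext _ _ (by
    change (ρ_ c).hom ▷ d.X = (α_ c (𝟙_ C) d.X).hom ≫ c ◁ (λ_ d.X).hom
    simp)

end RightMod

end RightModules

end RelCenter

end

noncomputable section

namespace RelCenter

/-! ### Projective generators and representability -/

section Representability

open Limits ZeroObject

attribute [local instance] Abelian.hasFiniteBiproducts

variable (k : Type*) [Field k] (D : Type*) [Category* D] [Abelian D] [Linear k D]
  [IsFiniteLinear k D]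

/-! Under the adjunction `φ`, a family `E ⟶ Hom(m, m)` is a family `z_m : E ▷ m ⟶ m`. Dinaturality
becomes naturality, and compatibility with `β`, once `v*` is bent back by duality, says that `z`
commutes with the half-braidings of the objects `G(v)` (`isRelWedge_iff`, `slides_iff_gamma`). So a
relative end is an object `A` representing `E ↦ {sliding z : E ▷ - ⟶ id}`, with universal element
`e` (`IsUniversal`). The arguments run in the monoidal category `Act C M`, where such a `z` is a
morphism to the unit and string diagrams apply.

Rigidity of `C` strengthens universality: a sliding `E ▷ - ⟶ X ▷ -` factors uniquely through `X ◁ e`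
(`existsUnique_tensor`). Applied to `e ▷ X` this produces `σ_X`; naturality and the hexagon follow
from uniqueness, invertibility from duals. That `e` slides past `G(v)` now says that `σ_{G(v)}`
inverts the half-braiding of `G(v)` at `A`, so `A` is relatively central. Conversely, for a pair
with `Z` relatively central the compatibility at `X = G(v)` is the sliding condition
(`slides_of_compat`). Hence `z` factors uniquely through `e`, and by uniqueness the factor respects
half-braidings: this is terminality. Since `A ⊗ A` and `𝟙` also act on `M`, terminality supplies
multiplication and unit, and the axioms and commutativity may be checked after composing with `e`.

For right `B`-modules, an acting family is determined by its component on the regular module, hence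
by its value `ζ : Z ⟶ B` on the unit of `B`. Acting families correspond in this way to centralizing
`ζ`, naturally in `Z` (`Relates`), so the two terminality statements agree.

Internal Homs and the relative end exist because a contravariant linear functor with
finite-dimensional values that takes cokernels to kernels is representable on a finite category
(`exists_representing`). -/

include k in
theorem exists_projective_detecting_zero :
    ∃ P : D, Projective P ∧ ∀ X : D, (∀ f : P ⟶ X, f = 0) → IsZero X := by
  obtain ⟨n, S, hS⟩ := IsFiniteLinear.finite_simples k (D := D)
  have := IsFiniteLinear.enoughProjectives k (D := D)
  -- The generator is a sum of projectives covering the finitely many simples. A nonzero `X`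
  -- contains some simple `S i`, and projection, cover and inclusion compose to a nonzero map to
  -- `X`.
  refine ⟨⨁ fun i => Projective.over (S i), ⟨fun f e _ =>
    ⟨biproduct.desc fun i => Projective.factorThru
        (biproduct.ι (fun i => Projective.over (S i)) i ≫ f) e,
      biproduct.hom_ext' _ _ fun i => by
        rw [biproduct.ι_desc_assoc, Projective.factorThru_comp]⟩⟩, fun X hX => ?_⟩
  by_contra h
  have : IsArtinianObject X := IsFiniteLinear.artinian k X
  obtain ⟨Y, hY⟩ := exists_simple_subobject h
  obtain ⟨i, ⟨t⟩⟩ := hS (Y : D) hY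
  have h0 : biproduct.π (fun i => Projective.over (S i)) i ≫ Projective.π (S i) ≫ t.inv = 0 := by
    rw [← cancel_mono Y.arrow, zero_comp, hX (_ ≫ _)]
  have h1 : (𝟙 (Y : D)) = 0 := by
    rw [← cancel_epi (biproduct.π (fun i => Projective.over (S i)) i ≫ Projective.π (S i) ≫ t.inv),
      comp_zero, Category.comp_id, h0]
  exact Simple.not_isZero (Y : D) ((IsZero.iff_id_eq_zero _).2 h1)

include k in
-- Every map from `P` to the image of `f` lifts to the source of `f` by projectivity, so detection
-- of zero objects can be applied to that image.
theorem exists_projective_separator :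
    ∃ P : D, Projective P ∧
      ∀ {X Y : D} (f : X ⟶ Y), (∀ g : P ⟶ X, g ≫ f = 0) → f = 0 := by
  obtain ⟨P, hP, h⟩ := exists_projective_detecting_zero k D
  refine ⟨P, hP, fun {X Y} f hf => ?_⟩
  have hz : IsZero (image f) := h _ fun g => by
    rw [← cancel_mono (image.ι f), zero_comp, ← Projective.factorThru_comp g (factorThruImage f),
      Category.assoc, image.fac, hf]
  rw [← image.fac f, hz.eq_of_src (image.ι f) 0, comp_zero]

variable {D}

include k in
-- A finite spanning set of `P ⟶ X` is assembled into one map. A morphism killing this map kills the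
-- whole span, hence vanishes by separation.
theorem exists_epi_of_separator {P : D} [Projective P]
    (hP : ∀ {X Y : D} (f : X ⟶ Y), (∀ g : P ⟶ X, g ≫ f = 0) → f = 0) (X : D) :
    ∃ (n : ℕ) (p : (⨁ fun _ : Fin n => P) ⟶ X), Epi p := by
  have := IsFiniteLinear.finite_hom (k := k) P X
  obtain ⟨n, s, hs⟩ := Module.Finite.exists_fin (R := k) (M := P ⟶ X)
  refine ⟨n, biproduct.desc s, Preadditive.epi_of_cancel_zero _ fun {Y} g hg => hP g fun f => ?_⟩
  have hi : ∀ i, s i ≫ g = 0 := fun i => by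
    rw [← biproduct.ι_desc s i, Category.assoc, hg, comp_zero]
  have : f ∈ LinearMap.ker (Linear.rightComp k P g) := by
    have hle : Submodule.span k (Set.range s) ≤ LinearMap.ker (Linear.rightComp k P g) := by
      rw [Submodule.span_le]
      rintro _ ⟨i, rfl⟩
      exact hi i
    exact hle (hs ▸ Submodule.mem_top)
  exact this

variable {k}

/-- A `k`-linear contravariant functor with finite-dimensional values on a finite `k`-linear
category which takes cokernels to kernels is representable. -/
theorem exists_representing
    (F : D → Type*) [∀ X, AddCommGroup (F X)] [∀ X, Module k (F X)] [∀ X, Module.Finite k (F X)]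
    (map : ∀ {X Y : D}, (X ⟶ Y) →ₗ[k] F Y →ₗ[k] F X)
    (map_id : ∀ {X : D} (x : F X), map (𝟙 X) x = x)
    (map_comp : ∀ {X Y Z : D} (f : X ⟶ Y) (g : Y ⟶ Z) (x : F Z),
      map (f ≫ g) x = map f (map g x))
    (desc : ∀ {X Y : D} (f : X ⟶ Y) (y : F Y), map f y = 0 →
      ∃ z : F (cokernel f), map (cokernel.π f) z = y) :
    ∃ (R : D) (u : F R), ∀ (X : D) (x : F X), ∃! h : X ⟶ R, map h u = x := by
  obtain ⟨P, hP, sep⟩ := exists_projective_separator k D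
  have : ∀ X : D, Module.Finite k (P ⟶ X) := fun X => IsFiniteLinear.finite_hom P X
  let ℓ : D → ℕ := fun X => Module.finrank k (P ⟶ X)
  -- `Red (X, x)` says that the transformation `Hom(-, X) ⟶ F` given by `x` is injective. Evaluating
  -- it at `P` bounds `ℓ X` by `dim F(P)`, so a reduced pair with `ℓ` maximal exists; it will
  -- represent `F`.
  let Red : (Σ X : D, F X) → Prop := fun x => ∀ {L : D} (f : L ⟶ x.1), map f x.2 = 0 → f = 0
  have bound : ∀ x, Red x → ℓ x.1 ≤ Module.finrank k (F P) := fun x hx =>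
    LinearMap.finrank_le_finrank_of_injective (f := (map (X := P) (Y := x.1)).flip x.2)
      ((injective_iff_map_eq_zero _).2 fun f hf => hx f hf)
  obtain ⟨⟨X, x⟩, hx, hmax⟩ : ∃ x, Red x ∧ ∀ y, Red y → ℓ y.1 ≤ ℓ x.1 := by
    obtain ⟨x, hx, hmin⟩ := (measure fun x : Σ X : D, F X =>
      Module.finrank k (F P) - ℓ x.1).wf.has_min {x | Red x}
      ⟨⟨0, 0⟩, fun f _ => (isZero_zero D).eq_of_tgt _ _⟩
    refine ⟨x, hx, fun y hy => ?_⟩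
    have h1 := hmin y hy
    have h2 := bound x hx
    have h3 := bound y hy
    change ¬ (Module.finrank k (F P) - ℓ y.1 < Module.finrank k (F P) - ℓ x.1) at h1
    omega
  refine ⟨X, x, fun Y y => ?_⟩
  -- To pull `y` back from `x`, the two are put together on `X ⊞ Y` and `(Z, z)` is chosen as the
  -- smallest quotient to which the result descends.
  let w : F (X ⊞ Y) := map biprod.fst x + map biprod.snd y
  obtain ⟨⟨Z, q, z⟩, ⟨hq, hz⟩, hmin⟩ :=
    (measure fun t : (Σ Z : D, (X ⊞ Y ⟶ Z) × F Z) => ℓ t.1).wf.has_min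
      {t | Epi t.2.1 ∧ map t.2.1 t.2.2 = w} ⟨⟨X ⊞ Y, 𝟙 _, w⟩, inferInstance, map_id w⟩
  dsimp only at hq hz
  -- If `i` kills `z`, then `z` descends further to `cokernel i`. Minimality makes the surjection
  -- `Hom(P, Z) ⟶ Hom(P, cokernel i)` bijective, so every `P ⟶ L ⟶ Z` vanishes and `i = 0`.
  have hZ : Red ⟨Z, z⟩ := fun {L} i hi => by
    obtain ⟨z', hz'⟩ := desc i z hi
    have hle : ℓ Z ≤ ℓ (cokernel i) := by
      have := hmin ⟨cokernel i, q ≫ cokernel.π i, z'⟩ ⟨epi_comp _ _, by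
        dsimp only; rw [map_comp, hz', hz]⟩
      exact not_lt.1 this
    have hsurj : Function.Surjective (Linear.rightComp k P (cokernel.π i)) := fun f =>
      ⟨Projective.factorThru f (cokernel.π i), Projective.factorThru_comp _ _⟩
    have heq : Module.finrank k (P ⟶ Z) = Module.finrank k (P ⟶ cokernel i) :=
      le_antisymm hle (LinearMap.finrank_le_finrank_of_surjective hsurj)
    have hinj := (LinearMap.injective_iff_surjective_of_finrank_eq_finrank heq).2 hsurj
    exact sep i fun g => (injective_iff_map_eq_zero _).1 hinj (g ≫ i) (by simp)
  have hj : map (biprod.inl ≫ q) z = x := by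
    rw [map_comp, hz]
    simp [w, ← map_comp, map_id]
  have hy : map (biprod.inr ≫ q) z = y := by
    rw [map_comp, hz]
    simp [w, ← map_comp, map_id]
  have : Mono (biprod.inl ≫ q) := Preadditive.mono_of_cancel_zero _ fun {L} g hg => hx g (by
    dsimp only
    rw [← hj, ← map_comp, hg, _root_.map_zero, LinearMap.zero_apply])
  -- Maximality of `ℓ X` among reduced pairs turns the injection `Hom(P, X) ⟶ Hom(P, Z)` into a
  -- bijection. Thus `X ≅ Z`, and `Y ⟶ Z ≅ X` is the required morphism.
  have : Epi (biprod.inl ≫ q) := by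
    have hinj : Function.Injective (Linear.rightComp k P (biprod.inl ≫ q)) := fun f g h =>
      (cancel_mono (biprod.inl ≫ q)).1 h
    have heq : Module.finrank k (P ⟶ X) = Module.finrank k (P ⟶ Z) :=
      le_antisymm (LinearMap.finrank_le_finrank_of_injective hinj) (hmax ⟨Z, z⟩ hZ)
    have hsurj := (LinearMap.injective_iff_surjective_of_finrank_eq_finrank heq).1 hinj
    refine Preadditive.epi_of_cancel_zero _ fun g hg => sep g fun f => ?_
    obtain ⟨f', rfl⟩ := hsurj f
    rw [Linear.rightComp_apply, Category.assoc, hg, comp_zero]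
  have := isIso_of_mono_of_epi (biprod.inl ≫ q)
  refine ⟨(biprod.inr ≫ q) ≫ inv (biprod.inl ≫ q), ?_, fun h hh => ?_⟩
  · dsimp only
    conv_lhs => enter [2]; rw [← hj]
    rw [← map_comp, Category.assoc (biprod.inr ≫ q), IsIso.inv_hom_id, Category.comp_id, hy]
  · rw [← sub_eq_zero]
    refine hx _ ?_
    dsimp only
    rw [map_sub, LinearMap.sub_apply, hh, sub_eq_zero]
    conv_rhs => enter [2]; rw [← hj]
    rw [← map_comp, Category.assoc (biprod.inr ≫ q), IsIso.inv_hom_id, Category.comp_id, hy]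

end Representability

/-! ### The monoidal category of transformations between action functors -/

section Act

/-- The objects of `C`, regarded as the endofunctors `X ⊙ₗ -` of `M`. -/
structure Act (C : Type*) (M : Type*) where
  obj : C

variable {C : Type*} [Category* C] [MonoidalCategory C]
  {M : Type*} [Category* M] [MonoidalLeftAction C M]

namespace Act

/-- A natural transformation from `X ⊙ₗ -` to `Y ⊙ₗ -`. -/
@[ext]
structure Hom (X Y : Act C M) where
  app : ∀ m : M, X.obj ⊙ₗ m ⟶ Y.obj ⊙ₗ m
  naturality : ∀ {m n : M} (f : m ⟶ n), X.obj ⊴ₗ f ≫ app n = app m ≫ Y.obj ⊴ₗ f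

theorem Hom.naturality_assoc {X Y : Act C M} (f : Hom X Y) {m n : M} (g : m ⟶ n) {p : M}
    (h : Y.obj ⊙ₗ n ⟶ p) : X.obj ⊴ₗ g ≫ f.app n ≫ h = f.app m ≫ Y.obj ⊴ₗ g ≫ h := by
  rw [← Category.assoc, f.naturality, Category.assoc]

instance : Category (Act C M) where
  Hom X Y := Hom X Y
  id X := ⟨fun m => 𝟙 _, fun f => by simp⟩
  comp f g := ⟨fun m => f.app m ≫ g.app m, fun h => by
    rw [f.naturality_assoc, g.naturality, Category.assoc]⟩
  id_comp f := Hom.ext (by funext; exact Category.id_comp _)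
  comp_id f := Hom.ext (by funext; exact Category.comp_id _)
  assoc f g h := Hom.ext (by funext; exact Category.assoc _ _ _)

@[ext]
theorem hom_ext {X Y : Act C M} {f g : X ⟶ Y} (h : ∀ m, f.app m = g.app m) : f = g :=
  Hom.ext (funext h)

@[simp] theorem id_app (X : Act C M) (m : M) : Hom.app (𝟙 X) m = 𝟙 (X.obj ⊙ₗ m : M) := rfl

@[simp] theorem comp_app {X Y Z : Act C M} (f : X ⟶ Y) (g : Y ⟶ Z) (m : M) :
    (f ≫ g).app m = f.app m ≫ g.app m := rfl

variable (C M) in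
/-- The functor sending a morphism `f` of `C` to the transformation `f ⊵ₗ -`. -/
@[simps]
def functor : C ⥤ Act C M where
  obj X := ⟨X⟩
  map f := ⟨fun m => f ⊵ₗ m, fun g => action_exchange f g⟩

theorem whiskerLeft_naturality (X : C) {Y Y' : Act C M} (f : Y ⟶ Y') {m n : M} (h : m ⟶ n) :
    (X ⊗ Y.obj) ⊴ₗ h ≫ (αₗ X Y.obj n).hom ≫ X ⊴ₗ f.app n ≫ (αₗ X Y'.obj n).inv =
      ((αₗ X Y.obj m).hom ≫ X ⊴ₗ f.app m ≫ (αₗ X Y'.obj m).inv) ≫ (X ⊗ Y'.obj) ⊴ₗ h := by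
  simp only [tensor_actionHomRight, Category.assoc, Iso.inv_hom_id_assoc,
    ← actionHomRight_comp_assoc, f.naturality]

theorem whiskerRight_naturality {X X' : Act C M} (f : X ⟶ X') (Y : C) {m n : M} (h : m ⟶ n) :
    (X.obj ⊗ Y) ⊴ₗ h ≫ (αₗ X.obj Y n).hom ≫ f.app (Y ⊙ₗ n) ≫ (αₗ X'.obj Y n).inv =
      ((αₗ X.obj Y m).hom ≫ f.app (Y ⊙ₗ m) ≫ (αₗ X'.obj Y m).inv) ≫ (X'.obj ⊗ Y) ⊴ₗ h := by
  simp only [tensor_actionHomRight, Category.assoc, Iso.inv_hom_id_assoc, f.naturality_assoc]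

-- The tensor product and all constraints are those of `C`, so `functor C M` is strictly monoidal
-- and equations between morphisms of `C` carry over verbatim. What is new is that morphisms need
-- not come from `C`.
@[simps! tensorObj_obj tensorUnit_obj]
instance : MonoidalCategoryStruct (Act C M) where
  tensorObj X Y := ⟨X.obj ⊗ Y.obj⟩
  tensorUnit := ⟨𝟙_ C⟩
  whiskerLeft X Y Y' f := ⟨fun m =>
      (αₗ X.obj Y.obj m).hom ≫ X.obj ⊴ₗ f.app m ≫ (αₗ X.obj Y'.obj m).inv,
    whiskerLeft_naturality X.obj f⟩
  whiskerRight {X X'} f Y := ⟨fun m =>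
      (αₗ X.obj Y.obj m).hom ≫ f.app (Y.obj ⊙ₗ m) ≫ (αₗ X'.obj Y.obj m).inv,
    whiskerRight_naturality f Y.obj⟩
  tensorHom {X X' Y Y'} f g :=
    (⟨_, whiskerRight_naturality f Y.obj⟩ : (⟨X.obj ⊗ Y.obj⟩ : Act C M) ⟶ ⟨X'.obj ⊗ Y.obj⟩) ≫
    (⟨_, whiskerLeft_naturality X'.obj g⟩ : (⟨X'.obj ⊗ Y.obj⟩ : Act C M) ⟶ ⟨X'.obj ⊗ Y'.obj⟩)
  associator X Y Z := (functor C M).mapIso (α_ X.obj Y.obj Z.obj)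
  leftUnitor X := (functor C M).mapIso (λ_ X.obj)
  rightUnitor X := (functor C M).mapIso (ρ_ X.obj)

@[simp] theorem whiskerLeft_app (X : Act C M) {Y Z : Act C M} (f : Y ⟶ Z) (m : M) :
    (X ◁ f).app m = (αₗ X.obj Y.obj m).hom ≫ X.obj ⊴ₗ f.app m ≫ (αₗ X.obj Z.obj m).inv := rfl

@[simp] theorem whiskerRight_app {Y Z : Act C M} (f : Y ⟶ Z) (X : Act C M) (m : M) :
    (f ▷ X).app m = (αₗ Y.obj X.obj m).hom ≫ f.app (X.obj ⊙ₗ m) ≫ (αₗ Z.obj X.obj m).inv := rfl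

@[simp] theorem associator_hom_app (X Y Z : Act C M) (m : M) :
    (α_ X Y Z).hom.app m = (α_ X.obj Y.obj Z.obj).hom ⊵ₗ m := rfl

@[simp] theorem associator_inv_app (X Y Z : Act C M) (m : M) :
    (α_ X Y Z).inv.app m = (α_ X.obj Y.obj Z.obj).inv ⊵ₗ m := rfl

@[simp] theorem leftUnitor_hom_app (X : Act C M) (m : M) :
    (λ_ X).hom.app m = (λ_ X.obj).hom ⊵ₗ m := rfl

@[simp] theorem leftUnitor_inv_app (X : Act C M) (m : M) :
    (λ_ X).inv.app m = (λ_ X.obj).inv ⊵ₗ m := rfl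

@[simp] theorem rightUnitor_hom_app (X : Act C M) (m : M) :
    (ρ_ X).hom.app m = (ρ_ X.obj).hom ⊵ₗ m := rfl

@[simp] theorem rightUnitor_inv_app (X : Act C M) (m : M) :
    (ρ_ X).inv.app m = (ρ_ X.obj).inv ⊵ₗ m := rfl

theorem tensorHom_eq {X X' Y Y' : Act C M} (f : X ⟶ X') (g : Y ⟶ Y') :
    f ⊗ₘ g = f ▷ Y ≫ X' ◁ g := rfl

@[simp]
theorem whiskerLeft_map (X : Act C M) {Y Z : C} (f : Y ⟶ Z) :
    X ◁ (functor C M).map f = (functor C M).map (X.obj ◁ f) := by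
  ext m; exact (whiskerLeft_actionHomLeft X.obj f m).symm

@[simp]
theorem map_whiskerRight {Y Z : C} (f : Y ⟶ Z) (X : Act C M) :
    (functor C M).map f ▷ X = (functor C M).map (f ▷ X.obj) := by
  ext m; exact (whiskerRight_actionHomLeft X.obj f m).symm

theorem actionAssoc_inv_inv (X Y Z : C) (m : M) :
    (αₗ X Y (Z ⊙ₗ m)).inv ≫ (αₗ (X ⊗ Y) Z m).inv ≫ (α_ X Y Z).hom ⊵ₗ m =
      X ⊴ₗ (αₗ Y Z m).inv ≫ (αₗ X (Y ⊗ Z) m).inv := by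
  rw [Iso.inv_comp_eq, Iso.inv_comp_eq, ← associator_actionHom_assoc]
  simp

/-- The interchange law is the naturality of a transformation with respect to the components of
another one; the coherence axioms are images of those in `C`. -/
instance : MonoidalCategory (Act C M) :=
  MonoidalCategory.ofTensorHom
    (id_tensorHom_id := fun X Y => by ext m; simp [tensorHom_eq])
    (tensorHom_comp_tensorHom := fun f₁ f₂ g₁ g₂ => by
      ext m; simp [tensorHom_eq, g₁.naturality_assoc])
    (id_tensorHom := fun X _ _ f => by ext m; simp [tensorHom_eq])
    (tensorHom_id := fun f Y => by ext m; simp [tensorHom_eq])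
    (associator_naturality := fun f g h => by
      ext m; simp [tensorHom_eq, actionAssoc_inv_inv, ← f.naturality_assoc])
    (leftUnitor_naturality := fun f => by ext m; simp [tensorHom_eq])
    (rightUnitor_naturality := fun f => by ext m; simp [tensorHom_eq, f.naturality])
    (pentagon := fun W X Y Z => by
      ext m
      simpa [-whiskerLeft_actionHomLeft, -pentagon, ← whiskerLeft_actionHomLeft, tensorHom_eq,
        ← whiskerRight_actionHomLeft] using
        congrArg (fun f => f ⊵ₗ m) (pentagon W.obj X.obj Y.obj Z.obj))
    (triangle := fun X Y => by
      ext m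
      simpa [-whiskerLeft_actionHomLeft, -triangle, -leftUnitor_actionHom,
        ← whiskerLeft_actionHomLeft, tensorHom_eq, ← whiskerRight_actionHomLeft] using
        congrArg (fun f => f ⊵ₗ m) (triangle X.obj Y.obj))

end Act

end Act

/-! ### String diagrams in a monoidal category -/

section Diagrams

variable {K : Type*} [Category* K] [MonoidalCategory K]

/-- Balancing through an evaluation `D ⊗ Y ⟶ 𝟙` amounts to sliding `D` past `z`. -/
theorem balanced_iff {D Y E : K} (ev : D ⊗ Y ⟶ 𝟙_ K) (coev : 𝟙_ K ⟶ Y ⊗ D)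
    (zigzag : D ◁ coev ≫ (α_ _ _ _).inv ≫ ev ▷ D = (ρ_ D).hom ≫ (λ_ D).inv)
    (s : D ⊗ E ≅ E ⊗ D) (z : E ⟶ 𝟙_ K) :
    E ◁ ev ≫ (ρ_ E).hom ≫ z = (α_ E D Y).inv ≫ s.inv ▷ Y ≫ (α_ D E Y).hom ≫
        D ◁ (z ▷ Y ≫ (λ_ Y).hom) ≫ ev ↔
      s.hom ≫ z ▷ D ≫ (λ_ D).hom = D ◁ z ≫ (ρ_ D).hom := by
  constructor
  -- Insert the zigzag on the strand `D` and apply `h` to the evaluation it creates. Then `coev` is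
  -- free to move past `s.inv` and `z`, and the strand is pulled straight.
  · intro h
    rw [← Iso.eq_inv_comp]
    calc
      _ = 𝟙 _ ⊗≫ E ◁ ((ρ_ D).hom ≫ (λ_ D).inv) ⊗≫ z ▷ D ⊗≫ 𝟙 D := by monoidal
      _ = 𝟙 _ ⊗≫ E ◁ D ◁ coev ⊗≫ (E ◁ ev ≫ (ρ_ E).hom ≫ z) ▷ D ⊗≫ 𝟙 _ := by
        rw [← zigzag]; monoidal
      _ = 𝟙 _ ⊗≫ ((E ⊗ D) ◁ coev ≫ s.inv ▷ (Y ⊗ D)) ⊗≫ D ◁ z ▷ Y ▷ D ⊗≫ ev ▷ D ⊗≫ 𝟙 _ := by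
        rw [h]; monoidal
      _ = 𝟙 _ ⊗≫ s.inv ⊗≫ D ◁ (E ◁ coev ≫ z ▷ (Y ⊗ D)) ⊗≫ ev ▷ D ⊗≫ 𝟙 _ := by
        rw [whisker_exchange]; monoidal
      _ = 𝟙 _ ⊗≫ s.inv ⊗≫ D ◁ z ⊗≫ (D ◁ coev ≫ (α_ _ _ _).inv ≫ ev ▷ D) ⊗≫ 𝟙 _ := by
        rw [whisker_exchange]; monoidal
      _ = _ := by rw [zigzag]; monoidal
  · intro h
    calc
      _ = 𝟙 _ ⊗≫ (E ◁ ev ≫ z ▷ 𝟙_ K) ⊗≫ 𝟙 _ := by monoidal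
      _ = 𝟙 _ ⊗≫ (z ▷ D ≫ (λ_ D).hom) ▷ Y ⊗≫ ev ⊗≫ 𝟙 _ := by
        rw [whisker_exchange]; monoidal
      _ = 𝟙 _ ⊗≫ (s.inv ≫ D ◁ z ≫ (ρ_ D).hom) ▷ Y ⊗≫ ev ⊗≫ 𝟙 _ := by
        rw [← h, Iso.inv_hom_id_assoc]
      _ = _ := by monoidal

/-- Sliding is invariant under isomorphism of the object that slides. -/
theorem slide_of_iso {D D' E X : K} {s : D ⊗ E ⟶ E ⊗ D} {s' : D' ⊗ E ⟶ E ⊗ D'}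
    {t : D ⊗ X ⟶ X ⊗ D} {t' : D' ⊗ X ⟶ X ⊗ D'} (f : D' ⟶ D) [IsIso f] {w : E ⟶ X}
    (hs : f ▷ E ≫ s = s' ≫ E ◁ f) (ht : f ▷ X ≫ t = t' ≫ X ◁ f)
    (h : s ≫ w ▷ D = D ◁ w ≫ t) : s' ≫ w ▷ D' = D' ◁ w ≫ t' := by
  rw [← cancel_mono (X ◁ f), Category.assoc, Category.assoc, ← ht, ← whisker_exchange,
    ← reassoc_of% hs, h, whisker_exchange_assoc]

/-- The mate of a sliding morphism slides. -/
theorem slide_mate {D W X E : K} (ev : W ⊗ X ⟶ 𝟙_ K) {w : E ⟶ X}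
    {sW : D ⊗ W ⟶ W ⊗ D} {sE : D ⊗ E ⟶ E ⊗ D} {sX : D ⊗ X ⟶ X ⊗ D}
    {s₁ : D ⊗ 𝟙_ K ⟶ 𝟙_ K ⊗ D} (hw : sE ≫ w ▷ D = D ◁ w ≫ sX)
    (hev : ((α_ _ _ _).inv ≫ sW ▷ X ≫ (α_ _ _ _).hom ≫ W ◁ sX ≫ (α_ _ _ _).inv) ≫
      ev ▷ D = D ◁ ev ≫ s₁) :
    ((α_ _ _ _).inv ≫ sW ▷ E ≫ (α_ _ _ _).hom ≫ W ◁ sE ≫ (α_ _ _ _).inv) ≫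
      (W ◁ w ≫ ev) ▷ D = D ◁ (W ◁ w ≫ ev) ≫ s₁ := by
  calc
    _ = 𝟙 _ ⊗≫ sW ▷ E ⊗≫ W ◁ (sE ≫ w ▷ D) ⊗≫ ev ▷ D := by monoidal
    _ = 𝟙 _ ⊗≫ (sW ▷ E ≫ (W ⊗ D) ◁ w) ⊗≫ W ◁ sX ⊗≫ ev ▷ D := by rw [hw]; monoidal
    _ = 𝟙 _ ⊗≫ D ◁ W ◁ w ⊗≫
        (((α_ _ _ _).inv ≫ sW ▷ X ≫ (α_ _ _ _).hom ≫ W ◁ sX ≫ (α_ _ _ _).inv) ≫ ev ▷ D) := by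
      rw [← whisker_exchange]; monoidal
    _ = _ := by rw [hev]; monoidal

/-- A morphism is determined by its mate. -/
theorem eq_of_mate_eq {W X E : K} (ev : W ⊗ X ⟶ 𝟙_ K) (coev : 𝟙_ K ⟶ X ⊗ W)
    (zigzag : coev ▷ X ≫ (α_ _ _ _).hom ≫ X ◁ ev = (λ_ X).hom ≫ (ρ_ X).inv)
    {w w' : E ⟶ X} (h : W ◁ w ≫ ev = W ◁ w' ≫ ev) : w = w' := by
  have key : ∀ v : E ⟶ X, v = 𝟙 _ ⊗≫ coev ▷ E ⊗≫ X ◁ (W ◁ v ≫ ev) ⊗≫ 𝟙 _ := fun v => by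
    calc
      v = 𝟙 _ ⊗≫ v ⊗≫ ((λ_ X).hom ≫ (ρ_ X).inv) ⊗≫ 𝟙 _ := by monoidal
      _ = 𝟙 _ ⊗≫ (𝟙_ K ◁ v ≫ coev ▷ X) ⊗≫ X ◁ ev ⊗≫ 𝟙 _ := by rw [← zigzag]; monoidal
      _ = _ := by rw [whisker_exchange]; monoidal
  rw [key w, h, ← key w']

/-- Passing to mates turns factorization through `X ◁ e` into factorization through `e`. -/
theorem mate_whiskerLeft {W X A E : K} (ev : W ⊗ X ⟶ 𝟙_ K) (e : A ⟶ 𝟙_ K) (h : E ⟶ X ⊗ A) :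
    W ◁ (h ≫ X ◁ e ≫ (ρ_ X).hom) ≫ ev = (W ◁ h ≫ (α_ _ _ _).inv ≫ ev ▷ A ≫ (λ_ A).hom) ≫ e := by
  calc
    _ = 𝟙 _ ⊗≫ W ◁ h ⊗≫ ((W ⊗ X) ◁ e ≫ ev ▷ 𝟙_ K) ⊗≫ 𝟙 _ := by monoidal
    _ = _ := by rw [whisker_exchange]; monoidal

/-- If `e` slides past `D`, then so does `e ▷ X`. -/
theorem slide_whiskerRight {D A X : K} {e : A ⟶ 𝟙_ K}
    {sA : D ⊗ A ⟶ A ⊗ D} {sX : D ⊗ X ⟶ X ⊗ D}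
    (he : sA ≫ e ▷ D = D ◁ e ≫ (ρ_ D).hom ≫ (λ_ D).inv) :
    ((α_ _ _ _).inv ≫ sA ▷ X ≫ (α_ _ _ _).hom ≫ A ◁ sX ≫ (α_ _ _ _).inv) ≫
      (e ▷ X ≫ (λ_ X).hom) ▷ D = D ◁ (e ▷ X ≫ (λ_ X).hom) ≫ sX := by
  calc
    _ = 𝟙 _ ⊗≫ sA ▷ X ⊗≫ (A ◁ sX ≫ e ▷ (X ⊗ D)) ⊗≫ 𝟙 _ := by monoidal
    _ = 𝟙 _ ⊗≫ (sA ≫ e ▷ D) ▷ X ⊗≫ sX ⊗≫ 𝟙 _ := by rw [whisker_exchange]; monoidal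
    _ = _ := by rw [he]; monoidal

/-- If `e` slides past `D`, then so does `X ◁ e`. -/
theorem slide_whiskerLeft {D A X : K} {e : A ⟶ 𝟙_ K}
    {sA : D ⊗ A ⟶ A ⊗ D} {sX : D ⊗ X ⟶ X ⊗ D}
    (he : sA ≫ e ▷ D = D ◁ e ≫ (ρ_ D).hom ≫ (λ_ D).inv) :
    ((α_ _ _ _).inv ≫ sX ▷ A ≫ (α_ _ _ _).hom ≫ X ◁ sA ≫ (α_ _ _ _).inv) ≫
      (X ◁ e ≫ (ρ_ X).hom) ▷ D = D ◁ (X ◁ e ≫ (ρ_ X).hom) ≫ sX := by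
  calc
    _ = 𝟙 _ ⊗≫ sX ▷ A ⊗≫ X ◁ (sA ≫ e ▷ D) ⊗≫ 𝟙 _ := by monoidal
    _ = 𝟙 _ ⊗≫ (sX ▷ A ≫ (X ⊗ D) ◁ e) ⊗≫ 𝟙 _ := by rw [he]; monoidal
    _ = _ := by rw [← whisker_exchange]; monoidal

/-- The equation `h` is the one characterizing the half-braiding of a universal object. It is stable
under the hexagon composite, which gives the hexagon by uniqueness. -/
theorem whiskerRight_tensor_eq {A X X' : K} {e : A ⟶ 𝟙_ K} {s : A ⊗ X ⟶ X ⊗ A}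
    {s' : A ⊗ X' ⟶ X' ⊗ A} (h : s ≫ X ◁ e ≫ (ρ_ X).hom = e ▷ X ≫ (λ_ X).hom)
    (h' : s' ≫ X' ◁ e ≫ (ρ_ X').hom = e ▷ X' ≫ (λ_ X').hom) :
    ((α_ _ _ _).inv ≫ s ▷ X' ≫ (α_ _ _ _).hom ≫ X ◁ s' ≫ (α_ _ _ _).inv) ≫
      (X ⊗ X') ◁ e ≫ (ρ_ (X ⊗ X')).hom = e ▷ (X ⊗ X') ≫ (λ_ (X ⊗ X')).hom := by
  calc
    _ = 𝟙 _ ⊗≫ s ▷ X' ⊗≫ X ◁ (s' ≫ X' ◁ e ≫ (ρ_ X').hom) ⊗≫ 𝟙 _ := by monoidal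
    _ = 𝟙 _ ⊗≫ (s ≫ X ◁ e ≫ (ρ_ X).hom) ▷ X' ⊗≫ 𝟙 _ := by rw [h']; monoidal
    _ = _ := by rw [h]; monoidal

/-- Letting `Z'` act and then `Z` is compatible with the half-braiding of `Z ⊗ Z'`; this makes `A ⊗
A` an acting object. -/
theorem whiskerRight_tensor_eq' {Z Z' X : K} {z : Z ⟶ 𝟙_ K} {z' : Z' ⟶ 𝟙_ K}
    {s : Z ⊗ X ⟶ X ⊗ Z} {s' : Z' ⊗ X ⟶ X ⊗ Z'}
    (h : z ▷ X ≫ (λ_ X).hom = s ≫ X ◁ z ≫ (ρ_ X).hom)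
    (h' : z' ▷ X ≫ (λ_ X).hom = s' ≫ X ◁ z' ≫ (ρ_ X).hom) :
    (Z ◁ z' ≫ (ρ_ Z).hom ≫ z) ▷ X ≫ (λ_ X).hom =
      ((α_ _ _ _).hom ≫ Z ◁ s' ≫ (α_ _ _ _).inv ≫ s ▷ Z' ≫ (α_ _ _ _).hom) ≫
        X ◁ (Z ◁ z' ≫ (ρ_ Z).hom ≫ z) ≫ (ρ_ X).hom := by
  calc
    _ = 𝟙 _ ⊗≫ Z ◁ (z' ▷ X ≫ (λ_ X).hom) ⊗≫ (z ▷ X ≫ (λ_ X).hom) ⊗≫ 𝟙 _ := by monoidal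
    _ = 𝟙 _ ⊗≫ Z ◁ s' ⊗≫ ((Z ⊗ X) ◁ z' ≫ s ▷ 𝟙_ K) ⊗≫ X ◁ z ⊗≫ 𝟙 _ := by
      rw [h', h]; monoidal
    _ = _ := by rw [whisker_exchange]; monoidal

/-- A lax half-braiding is invertible at every object with a left dual. -/
theorem isIso_of_monoidal {A U W : K} (ev : U ⊗ W ⟶ 𝟙_ K) (coev : 𝟙_ K ⟶ W ⊗ U)
    (zigzag : U ◁ coev ≫ (α_ _ _ _).inv ≫ ev ▷ U = (ρ_ U).hom ≫ (λ_ U).inv)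
    (s : A ⊗ U ⟶ U ⊗ A) (t : A ⊗ W ⟶ W ⊗ A)
    (hev : ((α_ _ _ _).inv ≫ s ▷ W ≫ (α_ _ _ _).hom ≫ U ◁ t ≫ (α_ _ _ _).inv) ≫ ev ▷ A =
      A ◁ ev ≫ (ρ_ A).hom ≫ (λ_ A).inv)
    (hcoev : A ◁ coev ≫ (α_ _ _ _).inv ≫ t ▷ U ≫ (α_ _ _ _).hom ≫ W ◁ s ≫ (α_ _ _ _).inv =
      (ρ_ A).hom ≫ (λ_ A).inv ≫ coev ▷ A) : IsIso s := by
  -- The inverse of `s` is `t` rotated by the duality: create `W ⊗ U`, pass `A` across `W`, and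
  -- cancel `U ⊗ W`. The two composites are straightened using `hev` and `hcoev` respectively.
  refine ⟨𝟙 _ ⊗≫ (U ⊗ A) ◁ coev ⊗≫ U ◁ t ▷ U ⊗≫ ev ▷ (A ⊗ U) ⊗≫ 𝟙 _, ?_, ?_⟩
  · calc
      _ = 𝟙 _ ⊗≫ (s ▷ 𝟙_ K ≫ (U ⊗ A) ◁ coev) ⊗≫ U ◁ t ▷ U ⊗≫ ev ▷ (A ⊗ U) ⊗≫ 𝟙 _ := by monoidal
      _ = 𝟙 _ ⊗≫ A ◁ U ◁ coev ⊗≫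
          (((α_ _ _ _).inv ≫ s ▷ W ≫ (α_ _ _ _).hom ≫ U ◁ t ≫ (α_ _ _ _).inv) ≫ ev ▷ A) ▷ U
            ⊗≫ 𝟙 _ := by
        rw [← whisker_exchange]; monoidal
      _ = 𝟙 _ ⊗≫ A ◁ (U ◁ coev ≫ (α_ _ _ _).inv ≫ ev ▷ U) ⊗≫ 𝟙 _ := by rw [hev]; monoidal
      _ = _ := by rw [zigzag]; monoidal
  · calc
      _ = 𝟙 _ ⊗≫ (U ⊗ A) ◁ coev ⊗≫ U ◁ t ▷ U ⊗≫ (ev ▷ (A ⊗ U) ≫ 𝟙_ K ◁ s) ⊗≫ 𝟙 _ := by monoidal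
      _ = 𝟙 _ ⊗≫ U ◁ (A ◁ coev ≫ (α_ _ _ _).inv ≫ t ▷ U ≫ (α_ _ _ _).hom ≫ W ◁ s ≫
            (α_ _ _ _).inv) ⊗≫ ev ▷ U ▷ A ⊗≫ 𝟙 _ := by
        rw [← whisker_exchange]; monoidal
      _ = 𝟙 _ ⊗≫ (U ◁ coev ≫ (α_ _ _ _).inv ≫ ev ▷ U) ▷ A ⊗≫ 𝟙 _ := by rw [hcoev]; monoidal
      _ = _ := by rw [zigzag]; monoidal

end Diagrams

/-! ### Half-braidings acting on transformations -/

section HalfBraidings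

variable {C : Type*} [Category* C] [MonoidalCategory C]

/-- Monoidality at `𝟙 ⊗ 𝟙` together with naturality at `λ_ 𝟙` makes the component at the unit
idempotent up to unitors. Being invertible, it is trivial. -/
theorem halfBraiding_unit {X : C} (σ : HalfBraiding X) :
    (σ.β (𝟙_ C)).hom = (ρ_ X).hom ≫ (λ_ X).inv := by
  have h1 := σ.monoidal (𝟙_ C) (𝟙_ C)
  have h2 := σ.naturality (λ_ (𝟙_ C)).hom
  rw [h1] at h2
  have h3 : (σ.β (𝟙_ C)).hom ▷ 𝟙_ C ⊗≫ 𝟙_ C ◁ (σ.β (𝟙_ C)).hom ⊗≫ 𝟙 (𝟙_ C ⊗ X) =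
      𝟙 _ ⊗≫ (σ.β (𝟙_ C)).hom ⊗≫ 𝟙 (𝟙_ C ⊗ X) := by
    calc
      _ = 𝟙 _ ⊗≫ ((α_ _ _ _).inv ≫ (σ.β (𝟙_ C)).hom ▷ 𝟙_ C ≫ (α_ _ _ _).hom ≫
          𝟙_ C ◁ (σ.β (𝟙_ C)).hom ≫ (α_ _ _ _).inv) ≫ (λ_ (𝟙_ C)).hom ▷ X := by monoidal
      _ = _ := by rw [← h2]; monoidal
  rw [← cancel_epi ((σ.β (𝟙_ C)).hom ≫ (λ_ X).hom ≫ (ρ_ X).inv)]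
  calc
    _ = 𝟙 _ ⊗≫ ((σ.β (𝟙_ C)).hom ▷ 𝟙_ C ⊗≫ 𝟙_ C ◁ (σ.β (𝟙_ C)).hom ⊗≫ 𝟙 (𝟙_ C ⊗ X)) ⊗≫ 𝟙 _ := by
      monoidal
    _ = _ := by rw [h3]; monoidal

variable {M : Type*} [Category* M] [MonoidalLeftAction C M]

namespace Act

variable (M) in
/-- A morphism of `C` as a morphism of `Act C M`. -/
def tr {X Y : C} (f : X ⟶ Y) : (⟨X⟩ : Act C M) ⟶ ⟨Y⟩ := (functor C M).map f

@[simp] theorem tr_app {X Y : C} (f : X ⟶ Y) (m : M) : (tr M f).app m = f ⊵ₗ m := rfl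

theorem tr_comp {X Y Z : C} (f : X ⟶ Y) (g : Y ⟶ Z) :
    tr M (f ≫ g) = tr M f ≫ tr M g := (functor C M).map_comp f g

theorem tr_id (X : C) : tr M (𝟙 X) = 𝟙 _ := (functor C M).map_id X

theorem tr_whiskerLeft (X : C) {Y Z : C} (f : Y ⟶ Z) :
    tr M (X ◁ f) = (⟨X⟩ : Act C M) ◁ tr M f := (whiskerLeft_map ⟨X⟩ f).symm

theorem tr_whiskerRight {Y Z : C} (f : Y ⟶ Z) (X : C) :
    tr M (f ▷ X) = tr M f ▷ (⟨X⟩ : Act C M) := (map_whiskerRight f ⟨X⟩).symm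

/-- The half-braiding of `D`, as a morphism of `Act C M`. -/
def hb (D : Center C) (X : Act C M) : (⟨D.1⟩ : Act C M) ⊗ X ⟶ X ⊗ ⟨D.1⟩ :=
  tr M (D.2.β X.obj).hom

theorem hb_tensor (D : Center C) (X Y : Act C M) :
    hb D (X ⊗ Y) = (α_ _ _ _).inv ≫ hb D X ▷ Y ≫ (α_ _ _ _).hom ≫ X ◁ hb D Y ≫
      (α_ _ _ _).inv := by
  have h := congrArg (tr M) (D.2.monoidal X.obj Y.obj)
  simp only [tr_comp, tr_whiskerLeft, tr_whiskerRight] at h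
  exact h

theorem hb_unit (D : Center C) :
    hb D (𝟙_ (Act C M)) = (ρ_ (⟨D.1⟩ : Act C M)).hom ≫ (λ_ (⟨D.1⟩ : Act C M)).inv := by
  have h := congrArg (tr M) (halfBraiding_unit D.2)
  simp only [tr_comp] at h
  exact h

theorem hb_naturality (D : Center C) {X Y : C} (f : X ⟶ Y) :
    (⟨D.1⟩ : Act C M) ◁ tr M f ≫ hb D ⟨Y⟩ = hb D ⟨X⟩ ≫ tr M f ▷ ⟨D.1⟩ := by
  have h := congrArg (tr M) (D.2.naturality f)
  simp only [tr_comp, tr_whiskerLeft, tr_whiskerRight] at h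
  exact h

theorem hb_comm {D D' : Center C} (f : D ⟶ D') (X : Act C M) :
    tr M f.f ▷ X ≫ hb D' X = hb D X ≫ X ◁ tr M f.f := by
  have h := congrArg (tr M) (f.comm X.obj)
  simp only [tr_comp, tr_whiskerLeft, tr_whiskerRight] at h
  exact h

theorem hb_tensor_left (D D' : Center C) (X : Act C M) :
    hb (D ⊗ D') X = (α_ (⟨D.1⟩ : Act C M) ⟨D'.1⟩ X).hom ≫ (⟨D.1⟩ : Act C M) ◁ hb D' X ≫
      (α_ _ _ _).inv ≫ hb D X ▷ ⟨D'.1⟩ ≫ (α_ _ _ _).hom := by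
  refine (show hb (D ⊗ D') X = tr M ((α_ _ _ _).hom ≫ D.1 ◁ (D'.2.β X.obj).hom ≫
    (α_ _ _ _).inv ≫ (D.2.β X.obj).hom ▷ D'.1 ≫ (α_ _ _ _).hom) from rfl).trans ?_
  simp only [tr_comp, tr_whiskerLeft, tr_whiskerRight]
  rfl

end Act

end HalfBraidings

/-! ### Sliding transformations and their universal object -/

section Universal

open Act

variable {V : Type*} [Category* V] {C : Type*} [Category* C] [MonoidalCategory C]
  (G : V ⥤ Center C) {M : Type*} [Category* M] [MonoidalLeftAction C M]

/-- A transformation that is compatible with the half-braidings of all objects `G.obj v`. -/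
def Slides {X Y : Act C M} (w : X ⟶ Y) : Prop :=
  ∀ v : V, hb (G.obj v) X ≫ w ▷ ⟨(G.obj v).1⟩ = ⟨(G.obj v).1⟩ ◁ w ≫ hb (G.obj v) Y

variable {G}

theorem slides_tr {X Y : C} (f : X ⟶ Y) : Slides G (tr M f) := fun _ =>
  (hb_naturality _ f).symm

theorem Slides.comp {X Y Z : Act C M} {w : X ⟶ Y} {w' : Y ⟶ Z} (h : Slides G w)
    (h' : Slides G w') : Slides G (w ≫ w') := fun v => by
  rw [comp_whiskerRight, reassoc_of% (h v), h' v, MonoidalCategory.whiskerLeft_comp,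
    Category.assoc]

theorem Slides.mate {W X E : C} (ev : W ⊗ X ⟶ 𝟙_ C) {w : (⟨E⟩ : Act C M) ⟶ ⟨X⟩}
    (h : Slides G w) : Slides G ((⟨W⟩ : Act C M) ◁ w ≫ tr M ev) := fun v => by
  refine (congrArg (· ≫ _) (hb_tensor (G.obj v) ⟨W⟩ ⟨E⟩)).trans
    (slide_mate (tr M ev) (h v) ?_)
  rw [← hb_tensor]
  exact (hb_naturality _ ev).symm

theorem Slides.whiskerRight {A : C} {e : (⟨A⟩ : Act C M) ⟶ 𝟙_ _} (h : Slides G e) (X : C) :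
    Slides G (e ▷ ⟨X⟩ ≫ (λ_ (⟨X⟩ : Act C M)).hom) := fun v => by
  rw [hb_tensor]
  refine slide_whiskerRight ?_
  rw [h v, hb_unit]

theorem Slides.whiskerLeft {A : C} {e : (⟨A⟩ : Act C M) ⟶ 𝟙_ _} (h : Slides G e) (X : C) :
    Slides G ((⟨X⟩ : Act C M) ◁ e ≫ (ρ_ (⟨X⟩ : Act C M)).hom) := fun v => by
  rw [hb_tensor]
  refine slide_whiskerLeft ?_
  rw [h v, hb_unit]

/-- Relative centrality makes the half-braiding of `G(v)` at `Z` inverse to that of `Z` at `G(v)`.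
The compatibility `hz` at `X = G(v)` is therefore the sliding condition. -/
theorem slides_of_compat {Z : Center C} (hZ : IsRelCentral G Z) {z : (⟨Z.1⟩ : Act C M) ⟶ 𝟙_ _}
    (hz : ∀ X : C, z ▷ ⟨X⟩ ≫ (λ_ (⟨X⟩ : Act C M)).hom = hb Z ⟨X⟩ ≫ ⟨X⟩ ◁ z ≫ (ρ_ _).hom) :
    Slides G z := fun v => by
  have h1 : hb (G.obj v) (⟨Z.1⟩ : Act C M) ≫ hb Z ⟨(G.obj v).1⟩ = 𝟙 _ := by
    have h2 : (Z.2.β (G.obj v).1).hom ≫ ((G.obj v).2.β Z.1).hom = 𝟙 _ :=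
      congrArg Center.Hom.f (hZ v)
    -- A one-sided inverse of an isomorphism is two-sided.
    have h3 : ((G.obj v).2.β Z.1).hom ≫ (Z.2.β (G.obj v).1).hom = 𝟙 _ := by
      rw [← cancel_epi (Z.2.β (G.obj v).1).hom, reassoc_of% h2, Category.comp_id]
    have h4 := congrArg (tr M) h3
    rw [tr_comp, tr_id] at h4
    exact h4
  rw [hb_unit, ← cancel_mono (λ_ (⟨(G.obj v).1⟩ : Act C M)).hom, Category.assoc, hz,
    reassoc_of% h1]
  simp

variable (G) in
/-- The universal property of the relative end, in terms of transformations. -/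
structure IsUniversal (A : C) (e : (⟨A⟩ : Act C M) ⟶ 𝟙_ (Act C M)) : Prop where
  slides : Slides G e
  existsUnique : ∀ (E : C) (z : (⟨E⟩ : Act C M) ⟶ 𝟙_ (Act C M)), Slides G z →
    ∃! h : E ⟶ A, tr M h ≫ e = z

namespace IsUniversal

variable {A : C} {e : (⟨A⟩ : Act C M) ⟶ 𝟙_ (Act C M)} (hA : IsUniversal G A e)
include hA

theorem hom_ext {E : C} {f g : E ⟶ A} (h : tr M f ≫ e = tr M g ≫ e) : f = g :=
  (hA.existsUnique E (tr M g ≫ e) ((slides_tr g).comp hA.slides)).unique h rfl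

variable [RigidCategory C]

/-- The mate of `w` along the dual of `X` is a sliding morphism `Xᘁ ⊗ E ⟶ 𝟙`. It factors uniquely
through `e`, and `Hom(Xᘁ ⊗ E, A) ≅ Hom(E, X ⊗ A)` carries the factor back. -/
theorem existsUnique_tensor {E X : C} {w : (⟨E⟩ : Act C M) ⟶ ⟨X⟩} (hw : Slides G w) :
    ∃! h : E ⟶ X ⊗ A, tr M h ≫ (⟨X⟩ : Act C M) ◁ e ≫ (ρ_ _).hom = w := by
  have key : ∀ h : E ⟶ X ⊗ A, (⟨Xᘁ⟩ : Act C M) ◁ (tr M h ≫ (⟨X⟩ : Act C M) ◁ e ≫ (ρ_ _).hom) ≫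
      tr M (ε_ X Xᘁ) = tr M ((tensorLeftHomEquiv E X Xᘁ A).symm h) ≫ e := fun h => by
    refine (mate_whiskerLeft (tr M (ε_ X Xᘁ)) e (tr M h)).trans ?_
    congr 1
    change _ = tr M (Xᘁ ◁ h ≫ (α_ _ _ _).inv ≫ ε_ X Xᘁ ▷ A ≫ (λ_ A).hom)
    simp only [tr_comp, tr_whiskerLeft, tr_whiskerRight]
    rfl
  obtain ⟨h', h1, h2⟩ := hA.existsUnique _ _ (hw.mate (ε_ X Xᘁ))
  refine ⟨tensorLeftHomEquiv E X Xᘁ A h', ?_, fun h hh => ?_⟩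
  · refine eq_of_mate_eq (tr M (ε_ X Xᘁ)) (tr M (η_ X Xᘁ)) ?_ ?_
    · have := congrArg (tr M) (ExactPairing.evaluation_coevaluation X Xᘁ)
      simp only [tr_comp, tr_whiskerLeft, tr_whiskerRight] at this
      exact this
    · exact (key _).trans (by rw [Equiv.symm_apply_apply]; exact h1)
  · rw [← Equiv.symm_apply_eq]
    refine h2 _ ?_
    dsimp only at hh
    dsimp only
    rw [← key, hh]

theorem tensor_hom_ext {E X : C} {f g : E ⟶ X ⊗ A}
    (h : tr M f ≫ (⟨X⟩ : Act C M) ◁ e ≫ (ρ_ _).hom =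
      tr M g ≫ (⟨X⟩ : Act C M) ◁ e ≫ (ρ_ _).hom) : f = g := by
  exact (hA.existsUnique_tensor ((slides_tr g).comp (hA.slides.whiskerLeft X))).unique h rfl

/-- The component `s X` is the factorization of `e ▷ X` through `X ◁ e`. Each axiom compares two
morphisms to some `X ⊗ A`, hence may be checked after `X ◁ e`. -/
theorem exists_halfBraiding : ∃ σ : HalfBraiding A, ∀ X : C,
    tr M (σ.β X).hom ≫ (⟨X⟩ : Act C M) ◁ e ≫ (ρ_ _).hom = e ▷ ⟨X⟩ ≫ (λ_ _).hom := by
  choose s hs using fun X : C => (hA.existsUnique_tensor (hA.slides.whiskerRight X)).exists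
  have natural : ∀ {U U' : C} (f : U ⟶ U'), A ◁ f ≫ s U' = s U ≫ f ▷ A := fun {U U'} f => by
    refine hA.tensor_hom_ext ?_
    rw [tr_comp, Category.assoc, hs, tr_comp, tr_whiskerLeft, tr_whiskerRight, Category.assoc,
      whisker_exchange_assoc, leftUnitor_naturality, ← whisker_exchange_assoc,
      rightUnitor_naturality, ← reassoc_of% (hs U)]
  have monoidal : ∀ U U' : C, s (U ⊗ U') = (α_ _ _ _).inv ≫ s U ▷ U' ≫ (α_ _ _ _).hom ≫
      U ◁ s U' ≫ (α_ _ _ _).inv := fun U U' => by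
    refine hA.tensor_hom_ext ?_
    rw [hs]
    simp only [tr_comp, tr_whiskerLeft, tr_whiskerRight]
    exact (whiskerRight_tensor_eq (hs U) (hs U')).symm
  have unit : s (𝟙_ C) = (ρ_ A).hom ≫ (λ_ A).inv := by
    refine hA.tensor_hom_ext ?_
    rw [hs, tr_comp]
    change _ = ((ρ_ (⟨A⟩ : Act C M)).hom ≫ (λ_ (⟨A⟩ : Act C M)).inv) ≫
      𝟙_ (Act C M) ◁ e ≫ (ρ_ (𝟙_ (Act C M))).hom
    change e ▷ 𝟙_ (Act C M) ≫ (λ_ (𝟙_ (Act C M))).hom = _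
    monoidal
  have iso : ∀ U, IsIso (s U) := fun U => by
    -- The left dual of `U` supplies the pairing, and naturality of `s` at its evaluation and
    -- coevaluation supplies the two hypotheses.
    refine isIso_of_monoidal (ε_ ᘁU U) (η_ ᘁU U) (ExactPairing.coevaluation_evaluation _ _) (s U)
      (s ᘁU) ?_ ?_
    · rw [← monoidal, ← natural, unit]
    · have h := natural (η_ ᘁU U)
      rw [monoidal, unit, Category.assoc] at h
      exact h
  exact ⟨⟨fun U => asIso (s U), monoidal, natural⟩, hs⟩

theorem halfBraiding_ext {σ τ : HalfBraiding A}
    (hσ : ∀ X : C, tr M (σ.β X).hom ≫ (⟨X⟩ : Act C M) ◁ e ≫ (ρ_ _).hom =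
      e ▷ ⟨X⟩ ≫ (λ_ _).hom)
    (hτ : ∀ X : C, tr M (τ.β X).hom ≫ (⟨X⟩ : Act C M) ◁ e ≫ (ρ_ _).hom =
      e ▷ ⟨X⟩ ≫ (λ_ _).hom) : σ = τ := by
  have h : σ.β = τ.β := funext fun X => Iso.ext (hA.tensor_hom_ext ((hσ X).trans (hτ X).symm))
  cases σ; cases τ; cases h; rfl

end IsUniversal

namespace IsUniversal

variable [RigidCategory C]

variable {A : Center C} {e : (⟨A.1⟩ : Act C M) ⟶ 𝟙_ (Act C M)} (hA : IsUniversal G A.1 e)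
  (hσ : ∀ X : C, hb A (⟨X⟩ : Act C M) ≫ (⟨X⟩ : Act C M) ◁ e ≫ (ρ_ _).hom =
    e ▷ ⟨X⟩ ≫ (λ_ _).hom)
include hA hσ

/-- Composed with `G(v) ◁ e`, the double braiding becomes the half-braiding of `G(v)` followed by `e
▷ G(v)`. Since `e` slides, this is `G(v) ◁ e` again, and uniqueness of factorizations gives the
identity. -/
theorem isRelCentral : IsRelCentral G A := fun v => by
  have h : ((G.obj v).2.β A.1).hom ≫ (A.2.β (G.obj v).1).hom = 𝟙 _ := by
    refine hA.tensor_hom_ext ?_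
    rw [tr_comp, tr_id, Category.id_comp, Category.assoc]
    refine (congrArg (_ ≫ ·) (hσ (G.obj v).1)).trans ?_
    have h := hA.slides v
    rw [hb_unit] at h
    refine Eq.trans (b := hb (G.obj v) (⟨A.1⟩ : Act C M) ≫ e ▷ _ ≫ (λ_ _).hom) rfl ?_
    rw [reassoc_of% h]
    simp
  have h' : (A.2.β (G.obj v).1).hom ≫ ((G.obj v).2.β A.1).hom = 𝟙 _ := by
    rw [← cancel_epi ((G.obj v).2.β A.1).hom, reassoc_of% h, Category.comp_id]
  exact Center.ext _ _ h'

/-- The factor of `z` through `e` is automatically a morphism of the center: both sides of that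
condition agree after `X ◁ e`, because `z` and `e` are each compatible with their half-braidings. -/
theorem existsUnique_center {Z : Center C} (hZ : IsRelCentral G Z)
    {z : (⟨Z.1⟩ : Act C M) ⟶ 𝟙_ _}
    (hz : ∀ X : C, z ▷ ⟨X⟩ ≫ (λ_ (⟨X⟩ : Act C M)).hom = hb Z ⟨X⟩ ≫ ⟨X⟩ ◁ z ≫ (ρ_ _).hom) :
    ∃! f : Z ⟶ A, tr M f.f ≫ e = z := by
  obtain ⟨h, h1, h2⟩ := hA.existsUnique _ z (slides_of_compat hZ hz)
  refine ⟨⟨h, fun X => hA.tensor_hom_ext ?_⟩, h1, fun f hf => Center.ext _ _ (h2 f.f hf)⟩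
  rw [tr_comp, tr_comp, tr_whiskerLeft, tr_whiskerRight, Category.assoc, Category.assoc,
    ← MonoidalCategory.whiskerLeft_comp_assoc, h1]
  refine (congrArg (_ ≫ ·) (hσ X)).trans ?_
  rw [← comp_whiskerRight_assoc, h1, hz]
  rfl

end IsUniversal

end Universal

/-! ### The algebra structure on a universal object -/

section Centralizer

variable {K : Type*} [Category* K] [MonoidalCategory K] [BraidedCategory K]

theorem braiding_tensor_braiding {Z Z' X : K} (h : (β_ Z X).hom ≫ (β_ X Z).hom = 𝟙 _)
    (h' : (β_ Z' X).hom ≫ (β_ X Z').hom = 𝟙 _) :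
    (β_ (Z ⊗ Z') X).hom ≫ (β_ X (Z ⊗ Z')).hom = 𝟙 _ := by
  rw [BraidedCategory.braiding_tensor_left_hom, BraidedCategory.braiding_tensor_right_hom]
  calc
    _ = 𝟙 _ ⊗≫ Z ◁ (β_ Z' X).hom ⊗≫ ((β_ Z X).hom ≫ (β_ X Z).hom) ▷ Z' ⊗≫
        Z ◁ (β_ X Z').hom ⊗≫ 𝟙 _ := by monoidal
    _ = 𝟙 _ ⊗≫ Z ◁ ((β_ Z' X).hom ≫ (β_ X Z').hom) ⊗≫ 𝟙 _ := by rw [h]; monoidal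
    _ = _ := by rw [h']; monoidal

variable {V C : Type*} [Category* V] [Category* C] [MonoidalCategory C] {G : V ⥤ Center C}

theorem IsRelCentral.tensor {Z Z' : Center C} (h : IsRelCentral G Z) (h' : IsRelCentral G Z') :
    IsRelCentral G (Z ⊗ Z') := fun v => braiding_tensor_braiding (h v) (h' v)

theorem isRelCentral_unit : IsRelCentral G (𝟙_ (Center C)) := fun v => by
  rw [braiding_tensorUnit_left, braiding_tensorUnit_right]
  simp

end Centralizer

section ActingAlgebra

variable {K : Type*} [Category* K] [MonoidalCategory K] {A : K} {e : A ⟶ 𝟙_ K}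
  {mul : A ⊗ A ⟶ A} {one : 𝟙_ K ⟶ A} (hm : mul ≫ e = A ◁ e ≫ (ρ_ A).hom ≫ e) (ho : one ≫ e = 𝟙 _)

include hm ho in
-- After composing with `e`, a product of copies of `A` acts by iterating `e`. The algebra axioms
-- thus hold up to `e`, which the universal property later cancels.
theorem acting_one_mul : (one ▷ A ≫ mul) ≫ e = (λ_ A).hom ≫ e := by
  rw [Category.assoc, hm, ← whisker_exchange_assoc, rightUnitor_naturality_assoc, ho]
  monoidal

include hm ho in
theorem acting_mul_one : (A ◁ one ≫ mul) ≫ e = (ρ_ A).hom ≫ e := by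
  rw [Category.assoc, hm, ← MonoidalCategory.whiskerLeft_comp_assoc, ho]
  monoidal

include hm in
theorem acting_mul_assoc : (mul ▷ A ≫ mul) ≫ e = ((α_ A A A).hom ≫ A ◁ mul ≫ mul) ≫ e := by
  simp only [Category.assoc]
  rw [hm, ← whisker_exchange_assoc, rightUnitor_naturality_assoc, hm,
    ← MonoidalCategory.whiskerLeft_comp_assoc, hm]
  monoidal

include hm in
-- The half-braiding exchanges which factor acts first. Both orders give `e ⊗ e` by the interchange
-- law, as the two unitors agree on `𝟙`.
theorem acting_mul_comm {s : A ⊗ A ⟶ A ⊗ A}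
    (hs : s ≫ A ◁ e ≫ (ρ_ A).hom = e ▷ A ≫ (λ_ A).hom) : (s ≫ mul) ≫ e = mul ≫ e := by
  rw [Category.assoc, hm, reassoc_of% hs, ← leftUnitor_naturality, ← whisker_exchange_assoc,
    unitors_equal, rightUnitor_naturality]

end ActingAlgebra

namespace IsUniversal

open Act

variable {V : Type*} [Category* V] {C : Type*} [Category* C] [MonoidalCategory C]
  {G : V ⥤ Center C} {M : Type*} [Category* M] [MonoidalLeftAction C M]
  {A : Center C} {e : (⟨A.1⟩ : Act C M) ⟶ 𝟙_ (Act C M)}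

/-- An algebra structure on an object of the center that acts through `e`. -/
structure IsActing (e : (⟨A.1⟩ : Act C M) ⟶ 𝟙_ (Act C M))
    (mon : MonObj A) : Prop where
  mul : (tr M mon.mul.f : (⟨A.1⟩ : Act C M) ⊗ ⟨A.1⟩ ⟶ ⟨A.1⟩) ≫ e = ⟨A.1⟩ ◁ e ≫ (ρ_ _).hom ≫ e
  one : (tr M mon.one.f : 𝟙_ (Act C M) ⟶ ⟨A.1⟩) ≫ e = 𝟙 _

variable (hA : IsUniversal G A.1 e)
include hA

theorem isActing_unique {m₁ m₂ : MonObj A} (h₁ : IsActing e m₁)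
    (h₂ : IsActing e m₂) : m₁ = m₂ := by
  have h1 : m₁.one = m₂.one := Center.ext _ _ (hA.hom_ext (h₁.one.trans h₂.one.symm))
  have h2 : m₁.mul = m₂.mul := Center.ext _ _ (hA.hom_ext (h₁.mul.trans h₂.mul.symm))
  cases m₁; cases m₂; cases h1; cases h2; rfl

variable [RigidCategory C]
  (hσ : ∀ X : C, hb A (⟨X⟩ : Act C M) ≫ (⟨X⟩ : Act C M) ◁ e ≫ (ρ_ _).hom =
    e ▷ ⟨X⟩ ≫ (λ_ _).hom)
include hσ

/-- `A ⊗ A` with the iterated action and `𝟙` with the identity are relatively central acting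
objects, so each has a unique map to `A` compatible with the actions. -/
theorem exists_isActing : ∃ mon : MonObj A, IsActing e mon := by
  have hc := hA.isRelCentral hσ
  obtain ⟨mul, hm, -⟩ := hA.existsUnique_center hσ (hc.tensor hc)
    (z := (⟨A.1⟩ : Act C M) ◁ e ≫ (ρ_ _).hom ≫ e) fun X => by
      rw [hb_tensor_left]
      exact whiskerRight_tensor_eq' (hσ X).symm (hσ X).symm
  obtain ⟨one, ho, -⟩ := hA.existsUnique_center hσ isRelCentral_unit (z := 𝟙 (𝟙_ (Act C M)))
    fun X => by
      have : hb (𝟙_ (Center C)) (⟨X⟩ : Act C M) = (λ_ (⟨X⟩ : Act C M)).hom ≫ (ρ_ _).inv :=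
        tr_comp _ _
      have key : 𝟙 (𝟙_ (Act C M)) ▷ ⟨X⟩ ≫ (λ_ (⟨X⟩ : Act C M)).hom =
          ((λ_ (⟨X⟩ : Act C M)).hom ≫ (ρ_ _).inv) ≫ (⟨X⟩ : Act C M) ◁ 𝟙 (𝟙_ (Act C M)) ≫
            (ρ_ _).hom := by simp
      exact key.trans (congrArg (· ≫ _) this.symm)
  let mul' : (⟨A.1⟩ : Act C M) ⊗ ⟨A.1⟩ ⟶ ⟨A.1⟩ := tr M mul.f
  let one' : 𝟙_ (Act C M) ⟶ ⟨A.1⟩ := tr M one.f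
  have hm' : mul' ≫ e = (⟨A.1⟩ : Act C M) ◁ e ≫ (ρ_ _).hom ≫ e := hm
  have ho' : one' ≫ e = 𝟙 _ := ho
  refine ⟨⟨one, mul, ?_, ?_, ?_⟩, hm, ho⟩
  · refine Center.ext _ _ (hA.hom_ext ?_)
    refine (congrArg (· ≫ e) ?_).trans (acting_one_mul hm' ho')
    exact (tr_comp (one.f ▷ A.1) mul.f).trans (congrArg (· ≫ _) (tr_whiskerRight _ _))
  · refine Center.ext _ _ (hA.hom_ext ?_)
    refine (congrArg (· ≫ e) ?_).trans (acting_mul_one hm' ho')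
    exact (tr_comp (A.1 ◁ one.f) mul.f).trans (congrArg (· ≫ _) (tr_whiskerLeft _ _))
  · refine Center.ext _ _ (hA.hom_ext ?_)
    refine (congrArg (· ≫ e) ?_).trans ((acting_mul_assoc hm').trans (congrArg (· ≫ e) ?_))
    · exact (tr_comp (mul.f ▷ A.1) mul.f).trans (congrArg (· ≫ _) (tr_whiskerRight _ _))
    · refine Eq.symm ((tr_comp (α_ A.1 A.1 A.1).hom (A.1 ◁ mul.f ≫ mul.f)).trans ?_)
      refine congrArg (_ ≫ ·) ((tr_comp (A.1 ◁ mul.f) mul.f).trans ?_)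
      exact congrArg (· ≫ _) (tr_whiskerLeft _ _)

omit [RigidCategory C] in
theorem isCommMonObj {mon : MonObj A} (h : IsActing e mon) :
    IsCommMonObj A := by
  refine ⟨Center.ext _ _ (hA.hom_ext ?_)⟩
  refine (congrArg (· ≫ e) ?_).trans (acting_mul_comm h.mul (hσ A.1))
  exact tr_comp _ _

end IsUniversal

/-! ### Relative wedges as sliding transformations -/

section Duality

variable {V : Type*} [Category* V] [MonoidalCategory V]
  {C : Type*} [Category* C] [MonoidalCategory C]

/-- A strong monoidal functor preserves dualities; this is the zigzag that `balanced_iff` needs for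
`G(v*)` and `G(v)`. -/
theorem monoidal_zigzag (F : V ⥤ C) [F.Monoidal] {v w : V} [ExactPairing v w] :
    F.obj w ◁ (ε F ≫ F.map (η_ v w) ≫ δ F v w) ≫ (α_ _ _ _).inv ≫
      (μ F w v ≫ F.map (ε_ v w) ≫ η F) ▷ F.obj w = (ρ_ _).hom ≫ (λ_ _).inv := by
  have h := congrArg F.map (ExactPairing.coevaluation_evaluation v w)
  simp only [Functor.map_comp, Functor.Monoidal.map_whiskerLeft,
    Functor.Monoidal.map_whiskerRight, Functor.Monoidal.map_associator_inv, Category.assoc,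
    Functor.Monoidal.μ_δ_assoc] at h
  rw [Functor.LaxMonoidal.right_unitality, Functor.OplaxMonoidal.left_unitality]
  simp only [MonoidalCategory.whiskerLeft_comp, comp_whiskerRight, Category.assoc]
  rw [← reassoc_of% h, Functor.Monoidal.μ_δ_assoc, Functor.Monoidal.μ_δ_assoc]
end Duality

section Associativity

variable {C : Type*} [Category* C] [MonoidalCategory C]
  {M : Type*} [Category* M] [MonoidalLeftAction C M]

theorem associator_inv_actionHom (X Y Z : C) (m : M) : (α_ X Y Z).inv ⊵ₗ m =
    (αₗ X (Y ⊗ Z) m).hom ≫ X ⊴ₗ (αₗ Y Z m).hom ≫ (αₗ X Y (Z ⊙ₗ m)).inv ≫ (αₗ (X ⊗ Y) Z m).inv := by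
  rw [← cancel_epi ((α_ X Y Z).hom ⊵ₗ m), hom_inv_actionHomLeft, associator_actionHom_assoc]
  simp

end Associativity

section Wedges

open Act

variable {V : Type*} [Category* V] [MonoidalCategory V] [BraidedCategory V] [RigidCategory V]
  {C : Type*} [Category* C] [MonoidalCategory C]
  (G : V ⥤ Center C) [G.Braided]
  {M : Type*} [Category* M] [MonoidalLeftAction C M]
/-- A natural family `E ⊙ₗ m ⟶ m` as a morphism to the unit of `Act C M`. -/
def Act.ofFamily {E : C} (z : ∀ m : M, E ⊙ₗ m ⟶ m)
    (hz : ∀ {m n : M} (f : m ⟶ n), E ⊴ₗ f ≫ z n = z m ≫ f) :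
    (⟨E⟩ : Act C M) ⟶ 𝟙_ (Act C M) :=
  ⟨fun m => z m ≫ (λₗ m).inv, fun f => by simp [reassoc_of% hz f]⟩

/-- The half-braiding of `D` as an isomorphism of `Act C M`. -/
def hbIso (D : Center C) (X : Act C M) : (⟨D.1⟩ : Act C M) ⊗ X ≅ X ⊗ ⟨D.1⟩ :=
  (functor C M).mapIso (D.2.β X.obj)

/-- The evaluation `G(v*) ⊗ G(v) ⟶ 𝟙` in `Act C M`. -/
def evAct (M : Type*) [Category* M] [MonoidalLeftAction C M] (v : V) :
    (⟨(G.obj vᘁ).1⟩ : Act C M) ⊗ ⟨(G.obj v).1⟩ ⟶ 𝟙_ (Act C M) :=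
  tr M (evG G v)

/-- With `ev_app`, this matches the two sides of the diagram in `balanced_iff` with the two sides of
the balancing condition, component by component. -/
theorem gamma_app {E : C} (z : (⟨E⟩ : Act C M) ⟶ 𝟙_ (Act C M)) (v : V) (m : M) :
    ((α_ _ _ _).inv ≫ (hbIso (G.obj vᘁ) ⟨E⟩).inv ▷ ⟨(G.obj v).1⟩ ≫ (α_ _ _ _).hom ≫
      ⟨(G.obj vᘁ).1⟩ ◁ (z ▷ ⟨(G.obj v).1⟩ ≫ (λ_ _).hom) ≫ evAct G M v).app m ≫ (λₗ m).hom =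
    (αₗ E ((G.obj vᘁ).1 ⊗ (G.obj v).1) m).hom ≫ E ⊴ₗ (αₗ (G.obj vᘁ).1 (G.obj v).1 m).hom ≫
      gammaMap G E v (vAct G v m) m (z.app (vAct G v m) ≫ (λₗ _).hom) := by
  have hs : (hbIso (G.obj vᘁ) (⟨E⟩ : Act C M)).inv.app =
    fun m => ((G.obj vᘁ).2.β E).inv ⊵ₗ m := rfl
  simp only [gammaMap, hs, associator_inv_actionHom, comp_app, whiskerLeft_app, whiskerRight_app,
    associator_inv_app, associator_hom_app, leftUnitor_hom_app, evAct, tr_app,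
    leftUnitor_actionHom, tensorObj_obj, tensorUnit_obj, actionHomRight_comp, Category.assoc,
    Iso.inv_hom_id_assoc]
  simp

theorem ev_app {E : C} (z : (⟨E⟩ : Act C M) ⟶ 𝟙_ (Act C M)) (v : V) (m : M) :
    ((⟨E⟩ : Act C M) ◁ evAct G M v ≫ (ρ_ _).hom ≫ z).app m ≫ (λₗ m).hom =
    (αₗ E ((G.obj vᘁ).1 ⊗ (G.obj v).1) m).hom ≫ E ⊴ₗ (αₗ (G.obj vᘁ).1 (G.obj v).1 m).hom ≫
      E ⊴ₗ ((αₗ (G.obj vᘁ).1 (G.obj v).1 m).inv ≫ evG G v ⊵ₗ m ≫ (λₗ m).hom) ≫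
        z.app m ≫ (λₗ _).hom := by
  simp [evAct]

omit [BraidedCategory V] [RigidCategory V] in
theorem map_ev_action (F : V ⥤ C) [F.Monoidal] {v w : V} (f : v ⊗ w ⟶ 𝟙_ V) (m : M) :
    F.map f ⊵ₗ m ≫ Functor.OplaxMonoidal.η F ⊵ₗ m ≫ (λₗ m).hom = (δ F v w ⊵ₗ m ≫ (αₗ _ _ m).hom) ≫ (αₗ _ _ m).inv ≫
      (μ F v w ≫ F.map f ≫ Functor.OplaxMonoidal.η F) ⊵ₗ m ≫ (λₗ m).hom := by
  simp only [Category.assoc, Iso.hom_inv_id_assoc, ← comp_actionHomLeft_assoc,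
    Functor.Monoidal.δ_μ_assoc]

theorem vEv_eq (v : V) (m : M) : vEv G v m = vAssoc G vᘁ v m ≫
    (αₗ (G.obj vᘁ).1 (G.obj v).1 m).inv ≫ evG G v ⊵ₗ m ≫ (λₗ m).hom :=
  map_ev_action (G ⋙ Center.forget C) _ m

instance (v w : V) (m : M) : IsIso (vAssoc G v w m) :=
  Iso.isIso_hom ((actionRight C m).mapIso
    (Functor.Monoidal.μIso (G ⋙ Center.forget C) v w).symm ≪≫ αₗ _ _ _)

omit [BraidedCategory V] in
-- Balancing at `v` controls only the object `G(v*)`. Since each object is a right dual, of its left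
-- dual, all of `G` is reached.
theorem exists_iso_rightDual (v : V) : ∃ w : V, Nonempty (v ≅ wᘁ) :=
  ⟨ᘁv, ⟨rightDualIso (X := ᘁv) HasLeftDual.exact (RightRigidCategory.rightDual (ᘁv)).exact⟩⟩

/-- `balanced_iff` trades balancing at `v` for sliding past `G(v*)`, and right duals exhaust `V` up
to isomorphism. -/
theorem slides_iff_gamma {E : C} (z : (⟨E⟩ : Act C M) ⟶ 𝟙_ (Act C M)) :
    Slides G z ↔ ∀ (v : V) (m : M), E ⊴ₗ vEv G v m ≫ z.app m ≫ (λₗ m).hom =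
      E ⊴ₗ vAssoc G vᘁ v m ≫ gammaMap G E v (vAct G v m) m (z.app _ ≫ (λₗ _).hom) := by
  have h1 : Slides G z ↔ ∀ v : V, (hbIso (G.obj vᘁ) ⟨E⟩).hom ≫ z ▷ ⟨(G.obj vᘁ).1⟩ ≫ (λ_ _).hom =
      ⟨(G.obj vᘁ).1⟩ ◁ z ≫ (ρ_ _).hom := by
    have h2 : ∀ v, (hb (G.obj v) ⟨E⟩ ≫ z ▷ ⟨(G.obj v).1⟩ =
        ⟨(G.obj v).1⟩ ◁ z ≫ hb (G.obj v) (𝟙_ (Act C M))) ↔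
        ((hbIso (G.obj v) ⟨E⟩).hom ≫ z ▷ ⟨(G.obj v).1⟩ ≫ (λ_ _).hom =
          ⟨(G.obj v).1⟩ ◁ z ≫ (ρ_ _).hom) := fun v => by
      rw [hb_unit, ← cancel_mono (λ_ (⟨(G.obj v).1⟩ : Act C M)).hom]
      simp only [Category.assoc, Iso.inv_hom_id, Category.comp_id]
      rfl
    refine ⟨fun h v => (h2 _).1 (h _), fun h v => ?_⟩
    obtain ⟨w, ⟨i⟩⟩ := exists_iso_rightDual v
    have : IsIso (tr M (G.map i.hom).f) :=
      Iso.isIso_hom ((G ⋙ Center.forget C ⋙ functor C M).mapIso i)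
    exact slide_of_iso (tr M (G.map i.hom).f) (hb_comm _ _) (hb_comm _ _) ((h2 _).2 (h w))
  rw [h1]
  refine forall_congr' fun v => ?_
  rw [← balanced_iff (evAct G M v) (tr M (ε (G ⋙ Center.forget C) ≫
    (G ⋙ Center.forget C).map (η_ v vᘁ) ≫ δ (G ⋙ Center.forget C) v vᘁ)) ?_]
  · constructor
    · intro h m
      have := congrArg (fun t => Hom.app t m ≫ (λₗ m).hom) h
      dsimp only at this
      rw [gamma_app, ev_app, cancel_epi, cancel_epi] at this
      rw [← this, vEv_eq, actionHomRight_comp, Category.assoc]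
    · intro h
      ext m
      rw [← cancel_mono (λₗ m).hom, gamma_app, ev_app, cancel_epi, cancel_epi,
        ← cancel_epi (E ⊴ₗ vAssoc G vᘁ v m), ← h, vEv_eq]
      simp only [actionHomRight_comp, Category.assoc]
  · have := congrArg (tr M) (monoidal_zigzag (G ⋙ Center.forget C) (v := v) (w := vᘁ))
    rw [tr_comp, tr_comp, tr_comp, tr_whiskerLeft, tr_whiskerRight] at this
    exact this

variable {G}

/-- `β` is defined on the universal evaluation only; naturality in `X` evaluates it along an
arbitrary `ξ`. -/
theorem gammaMap_naturality {X X' : C} (h : X' ⟶ X) (v : V) (m n : M) (f : X ⊙ₗ m ⟶ vAct G v n) :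
    h ⊵ₗ vAct G vᘁ m ≫ gammaMap G X v m n f = gammaMap G X' v m n (h ⊵ₗ m ≫ f) := by
  have hβ : h ▷ (G.obj vᘁ).1 ≫ ((G.obj vᘁ).2.β X).inv =
      ((G.obj vᘁ).2.β X').inv ≫ (G.obj vᘁ).1 ◁ h := by
    rw [Iso.comp_inv_eq, Category.assoc, HalfBraiding.naturality, Iso.inv_hom_id_assoc]
  have hβ' := congrArg (fun t => t ⊵ₗ m) hβ
  simp only [comp_actionHomLeft, whiskerLeft_actionHomLeft] at hβ'
  simp only [gammaMap, actionHomLeft_action, actionHomRight_comp, Category.assoc,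
    Iso.hom_inv_id_assoc, reassoc_of% hβ', Iso.inv_hom_id_assoc]

section IHom

variable (H : ∀ m n : M, IHom C m n)

omit [BraidedCategory V] [RigidCategory V] in
theorem ihom_φ_eq {X : C} {m n : M} (a : X ⟶ (H m n).obj) :
    (H m n).φ X a = a ⊵ₗ m ≫ ihomEv H m n := by
  rw [ihomEv, ← (H m n).φ_comp, Category.comp_id]

theorem ihom_hom_ext {X : C} {m n : M} {a b : X ⟶ (H m n).obj} :
    a = b ↔ a ⊵ₗ m ≫ ihomEv H m n = b ⊵ₗ m ≫ ihomEv H m n := by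
  rw [← ihom_φ_eq, ← ihom_φ_eq, EmbeddingLike.apply_eq_iff_eq]

@[simp]
theorem symm_actionHomLeft_ihomEv {X : C} {m n : M} (f : X ⊙ₗ m ⟶ n) :
    ((H m n).φ X).symm f ⊵ₗ m ≫ ihomEv H m n = f := by
  rw [← ihom_φ_eq, Equiv.apply_symm_apply]

/-- Both wedge conditions are equations of morphisms to an internal Hom. Applying `φ` turns the
first into naturality and the second into the `gammaMap` equation. -/
theorem isRelWedge_iff {E : C} (ξ : ∀ m : M, E ⟶ (H m m).obj) :
    IsRelWedge G H ξ ↔ ∃ hz : ∀ {m n : M} (f : m ⟶ n),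
      E ⊴ₗ f ≫ ξ n ⊵ₗ n ≫ ihomEv H n n = (ξ m ⊵ₗ m ≫ ihomEv H m m) ≫ f,
      Slides G (Act.ofFamily (fun m => ξ m ⊵ₗ m ≫ ihomEv H m m) hz) := by
  have h1 : ∀ {m n : M} (f : m ⟶ n), (ξ m ≫ ihomMapRight H m f = ξ n ≫ ihomMapLeft H f n ↔
      E ⊴ₗ f ≫ ξ n ⊵ₗ n ≫ ihomEv H n n = (ξ m ⊵ₗ m ≫ ihomEv H m m) ≫ f) := fun {m n} f => by
    rw [ihom_hom_ext]
    simp only [ihomMapRight, ihomMapLeft, comp_actionHomLeft, Category.assoc,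
      symm_actionHomLeft_ihomEv, ← action_exchange_assoc]
    exact eq_comm
  have h2 : ∀ (v : V) (m : M), (ξ m ≫ ihomMapLeft H (vEv G v m) m =
      ξ (vAct G v m) ≫ beta G H v (vAct G v m) m ≫ ihomMapLeft H (vAssoc G vᘁ v m) m) ↔
      (E ⊴ₗ vEv G v m ≫ ξ m ⊵ₗ m ≫ ihomEv H m m = E ⊴ₗ vAssoc G vᘁ v m ≫
        gammaMap G E v (vAct G v m) m (ξ _ ⊵ₗ _ ≫ ihomEv H _ _)) := fun v m => by
    rw [ihom_hom_ext, ← gammaMap_naturality]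
    simp only [beta, ihomMapLeft, comp_actionHomLeft, Category.assoc,
      symm_actionHomLeft_ihomEv, ← action_exchange_assoc]
  constructor
  · intro h
    have hz : ∀ {m n : M} (f : m ⟶ n),
      E ⊴ₗ f ≫ ξ n ⊵ₗ n ≫ ihomEv H n n = (ξ m ⊵ₗ m ≫ ihomEv H m m) ≫ f :=
      fun f => (h1 f).1 (h.dinatural f)
    refine ⟨hz, (slides_iff_gamma G _).2 fun v m => ?_⟩
    simpa [ofFamily] using (h2 v m).1 (h.balanced v m)
  · rintro ⟨hz, hs⟩
    refine ⟨fun f => (h1 f).2 (hz f), fun v m => (h2 v m).2 ?_⟩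
    simpa [ofFamily] using (slides_iff_gamma G _).1 hs v m

end IHom

end Wedges

/-! ### The relative end as a universal sliding transformation -/

section RelativeEnds

open Act

variable {V : Type*} [Category* V] [MonoidalCategory V] [BraidedCategory V] [RigidCategory V]
  {C : Type*} [Category* C] [MonoidalCategory C]
  {G : V ⥤ Center C} [G.Braided]
  {M : Type*} [Category* M] [MonoidalLeftAction C M] {H : ∀ m n : M, IHom C m n}

theorem RelativeEnd.e_naturality (A : RelativeEnd G H) {m n : M} (f : m ⟶ n) :
    A.obj ⊴ₗ f ≫ A.e n = A.e m ≫ f :=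
  ((isRelWedge_iff H A.π).1 A.isWedge).1 f

/-- The family `e` of a relative end, as a morphism of `Act C M`. -/
def RelativeEnd.eAct (A : RelativeEnd G H) : (⟨A.obj⟩ : Act C M) ⟶ 𝟙_ (Act C M) :=
  ofFamily A.e A.e_naturality

theorem RelativeEnd.eAct_app (A : RelativeEnd G H) (m : M) :
    A.eAct.app m = A.e m ≫ (λₗ m).inv := rfl

theorem isRelWedge_symm {E : C} {z : (⟨E⟩ : Act C M) ⟶ 𝟙_ (Act C M)} (hz : Slides G z) :
    IsRelWedge G H (fun m => ((H m m).φ E).symm (z.app m ≫ (λₗ m).hom)) := by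
  refine (isRelWedge_iff H _).2 ⟨fun {m n} f => ?_, ?_⟩
  · have := z.naturality f
    simp only [symm_actionHomLeft_ihomEv]
    rw [reassoc_of% this]
    simp
  · convert hz
    ext m
    simp [ofFamily]

theorem RelativeEnd.isUniversal (A : RelativeEnd G H) : IsUniversal G A.obj A.eAct where
  slides := ((isRelWedge_iff H A.π).1 A.isWedge).2
  existsUnique E z hz := by
    have key : ∀ h : E ⟶ A.obj, (tr M h ≫ A.eAct = z ↔
        ∀ m, h ≫ A.π m = ((H m m).φ E).symm (z.app m ≫ (λₗ m).hom)) := fun h => by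
      constructor
      · intro hh m
        rw [ihom_hom_ext, symm_actionHomLeft_ihomEv, ← hh]
        simp [RelativeEnd.eAct_app, RelativeEnd.e]
      · intro hh
        ext m
        have := (ihom_hom_ext H).1 (hh m)
        rw [symm_actionHomLeft_ihomEv] at this
        rw [← cancel_mono (λₗ m).hom]
        simpa [RelativeEnd.eAct_app, RelativeEnd.e] using this
    simp only [key]
    exact A.universal _ (isRelWedge_symm hz)

/-- A universal sliding transformation gives a relative end. -/
def IsUniversal.relativeEnd {A : C} {e : (⟨A⟩ : Act C M) ⟶ 𝟙_ (Act C M)}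
    (hA : IsUniversal G A e) (H : ∀ m n : M, IHom C m n) : RelativeEnd G H where
  obj := A
  π m := ((H m m).φ A).symm (e.app m ≫ (λₗ m).hom)
  isWedge := isRelWedge_symm hA.slides
  universal {E} ξ hξ := by
    obtain ⟨hz, hs⟩ := (isRelWedge_iff H ξ).1 hξ
    have key : ∀ h : E ⟶ A, (∀ m, h ≫ ((H m m).φ A).symm (e.app m ≫ (λₗ m).hom) = ξ m) ↔
        tr M h ≫ e = ofFamily (fun m => ξ m ⊵ₗ m ≫ ihomEv H m m) hz := fun h => by
      constructor
      · intro hh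
        ext m
        have := (ihom_hom_ext H).1 (hh m)
        simp only [comp_actionHomLeft, Category.assoc, symm_actionHomLeft_ihomEv] at this
        rw [← cancel_mono (λₗ m).hom]
        simpa [ofFamily] using this
      · intro hh m
        have := congrArg (fun t => Act.Hom.app t m ≫ (λₗ m).hom) hh
        rw [ihom_hom_ext]
        simpa [ofFamily] using this
    simp only [key]
    exact hA.existsUnique E _ hs

/-- `𝔞⁻¹` and `𝔟` are defined by evaluation, so `φ` turns the canonical equation into the
factorization of `e ▷ X` through `X ◁ e`. -/
theorem RelativeEnd.isCanonicalHalfBraiding_iff (A : RelativeEnd G H) (σ : HalfBraiding A.obj) :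
    A.IsCanonicalHalfBraiding σ ↔ ∀ X : C, hb (A.center σ) (⟨X⟩ : Act C M) ≫
      (⟨X⟩ : Act C M) ◁ A.eAct ≫ (ρ_ _).hom = A.eAct ▷ ⟨X⟩ ≫ (λ_ _).hom := by
  refine forall_congr' fun X => ?_
  constructor
  · intro h
    ext m
    have := (ihom_hom_ext H).1 (h m)
    simp only [ihomA, ihomB, comp_actionHomLeft, Category.assoc, symm_actionHomLeft_ihomEv] at this
    simp [RelativeEnd.eAct_app, RelativeEnd.e] at this ⊢
    exact this
  · intro h m
    rw [ihom_hom_ext]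
    have := congrArg (fun t => Act.Hom.app t m) h
    simp only [ihomA, ihomB, comp_actionHomLeft, Category.assoc, symm_actionHomLeft_ihomEv]
    simp [RelativeEnd.eAct_app, RelativeEnd.e] at this ⊢
    exact this

theorem RelativeEnd.mul_comp_π_iff (A : RelativeEnd G H) (mul : A.obj ⊗ A.obj ⟶ A.obj) (m : M) :
    mul ≫ A.π m = (A.π m ⊗ₘ A.π m) ≫ ihomComp H m m m ↔
      mul ⊵ₗ m ≫ A.e m = (αₗ A.obj A.obj m).hom ≫ A.obj ⊴ₗ A.e m ≫ A.e m := by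
  rw [ihom_hom_ext, comp_actionHomLeft, comp_actionHomLeft, Category.assoc, Category.assoc,
    ihomComp, symm_actionHomLeft_ihomEv, tensorHom_def', comp_actionHomLeft,
    whiskerLeft_actionHomLeft, whiskerRight_actionHomLeft]
  simp only [Category.assoc, Iso.inv_hom_id_assoc, ← action_exchange_assoc, RelativeEnd.e,
    actionHomRight_comp]

theorem RelativeEnd.one_comp_π_iff (A : RelativeEnd G H) (one : 𝟙_ C ⟶ A.obj) (m : M) :
    one ≫ A.π m = ihomUnit H m ↔ one ⊵ₗ m ≫ A.e m = (λₗ m).hom := by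
  rw [ihom_hom_ext, comp_actionHomLeft, Category.assoc, ihomUnit, symm_actionHomLeft_ihomEv,
    RelativeEnd.e]

theorem RelativeEnd.mul_action_iff (A : RelativeEnd G H) (mul : A.obj ⊗ A.obj ⟶ A.obj) :
    (∀ m : M, mul ⊵ₗ m ≫ A.e m = (αₗ A.obj A.obj m).hom ≫ A.obj ⊴ₗ A.e m ≫ A.e m) ↔
      (tr M mul : (⟨A.obj⟩ : Act C M) ⊗ ⟨A.obj⟩ ⟶ ⟨A.obj⟩) ≫ A.eAct =
        ⟨A.obj⟩ ◁ A.eAct ≫ (ρ_ _).hom ≫ A.eAct := by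
  have h : ∀ m, ((⟨A.obj⟩ : Act C M) ◁ A.eAct ≫ (ρ_ _).hom ≫ A.eAct).app m =
      ((αₗ A.obj A.obj m).hom ≫ A.obj ⊴ₗ A.e m ≫ A.e m) ≫ (λₗ m).inv := fun m => by
    simp [RelativeEnd.eAct_app]
  have h' : ∀ m, Act.Hom.app ((tr M mul : (⟨A.obj⟩ : Act C M) ⊗ ⟨A.obj⟩ ⟶ ⟨A.obj⟩) ≫ A.eAct) m =
      (mul ⊵ₗ m ≫ A.e m) ≫ (λₗ m).inv := fun m => (Category.assoc _ _ _).symm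
  constructor
  · intro hm
    ext m
    rw [h, h', hm]
  · intro hm m
    have := congrArg (fun t => Act.Hom.app t m) hm
    dsimp only at this
    rwa [h, h', cancel_mono] at this

theorem RelativeEnd.one_action_iff (A : RelativeEnd G H) (one : 𝟙_ C ⟶ A.obj) :
    (∀ m : M, one ⊵ₗ m ≫ A.e m = (λₗ m).hom) ↔
      (tr M one : 𝟙_ (Act C M) ⟶ ⟨A.obj⟩) ≫ A.eAct = 𝟙 _ := by
  have h' : ∀ m, Act.Hom.app ((tr M one : 𝟙_ (Act C M) ⟶ ⟨A.obj⟩) ≫ A.eAct) m =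
      (one ⊵ₗ m ≫ A.e m) ≫ (λₗ m).inv := fun m => (Category.assoc _ _ _).symm
  constructor
  · intro hm
    ext m
    rw [h', hm, Iso.hom_inv_id]
    rfl
  · intro hm m
    have := congrArg (fun t => Act.Hom.app t m) hm
    dsimp only at this
    rw [h'] at this
    rw [← cancel_mono (λₗ[C] m).inv, this, Iso.hom_inv_id]
    rfl

theorem RelativeEnd.isCanonicalAlgebra_iff (A : RelativeEnd G H) (σ : HalfBraiding A.obj)
    (mon : MonObj (A.center σ)) :
    A.IsCanonicalAlgebra σ mon ↔ IsUniversal.IsActing (A := A.center σ) A.eAct mon :=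
  ⟨fun h => ⟨(A.mul_action_iff mon.mul.f).1 fun m => (A.mul_comp_π_iff mon.mul.f m).1 (h.1 m),
    (A.one_action_iff mon.one.f).1 fun m => (A.one_comp_π_iff mon.one.f m).1 (h.2 m)⟩,
  fun h => ⟨fun m => (A.mul_comp_π_iff mon.mul.f m).2 ((A.mul_action_iff mon.mul.f).2 h.mul m),
    fun m => (A.one_comp_π_iff mon.one.f m).2 ((A.one_action_iff mon.one.f).2 h.one m)⟩⟩

theorem Act.compat_iff {Z : Center C} (z : (⟨Z.1⟩ : Act C M) ⟶ 𝟙_ (Act C M)) (X : C) :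
    (∀ m : M, (αₗ Z.1 X m).hom ≫ z.app (X ⊙ₗ m) ≫ (λₗ _).hom =
      (Z.2.β X).hom ⊵ₗ m ≫ (αₗ X Z.1 m).hom ≫ X ⊴ₗ (z.app m ≫ (λₗ _).hom)) ↔
    z ▷ ⟨X⟩ ≫ (λ_ (⟨X⟩ : Act C M)).hom = hb Z ⟨X⟩ ≫ ⟨X⟩ ◁ z ≫ (ρ_ _).hom := by
  have h : ∀ m, Act.Hom.app (z ▷ ⟨X⟩ ≫ (λ_ (⟨X⟩ : Act C M)).hom) m =
      (αₗ Z.1 X m).hom ≫ z.app (X ⊙ₗ m) ≫ (λₗ _).hom := fun m => by simp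
  have h' : ∀ m, Act.Hom.app (hb Z (⟨X⟩ : Act C M) ≫ ⟨X⟩ ◁ z ≫ (ρ_ _).hom) m =
      (Z.2.β X).hom ⊵ₗ m ≫ (αₗ X Z.1 m).hom ≫ X ⊴ₗ (z.app m ≫ (λₗ _).hom) := fun m => by
    simp [hb]
  constructor
  · intro hm
    ext m
    rw [h, h', hm]
  · intro hm m
    rw [← h, ← h', hm]

end RelativeEnds

/-! ### Existence of internal Homs and of relative ends -/

section Existence

open Limits

variable (k : Type*) [Field k] {C : Type*} [Category* C] [Abelian C] [Linear k C]
  [MonoidalCategory C] {M : Type*} [Category* M] [Abelian M] [Linear k M] [MonoidalLeftAction C M]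
  [IsModuleCategory k C M]

include k

theorem actionHomRight_add (X : C) {m n : M} (f g : m ⟶ n) :
    X ⊴ₗ (f + g) = X ⊴ₗ f + X ⊴ₗ g :=
  have := IsModuleCategory.additive_right k (M := M) X
  ((curriedAction C M).obj X).map_add

theorem actionHomRight_smul (X : C) {m n : M} (r : k) (f : m ⟶ n) :
    X ⊴ₗ (r • f) = r • X ⊴ₗ f :=
  have := IsModuleCategory.additive_right k (M := M) X
  have := IsModuleCategory.linear_right (k := k) (M := M) X
  ((curriedAction C M).obj X).map_smul _ _

theorem actionHomRight_zero (X : C) (m n : M) : X ⊴ₗ (0 : m ⟶ n) = 0 :=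
  have := IsModuleCategory.additive_right k (M := M) X
  ((curriedAction C M).obj X).map_zero _ _

theorem actionHomLeft_add {X Y : C} (f g : X ⟶ Y) (m : M) :
    (f + g) ⊵ₗ m = f ⊵ₗ m + g ⊵ₗ m :=
  have := IsModuleCategory.additive_left k (C := C) m
  ((curriedAction C M).flip.obj m).map_add

theorem actionHomLeft_smul {X Y : C} (r : k) (f : X ⟶ Y) (m : M) :
    (r • f) ⊵ₗ m = r • f ⊵ₗ m :=
  have := IsModuleCategory.additive_left k (C := C) m
  have := IsModuleCategory.linear_left (k := k) (C := C) m
  ((curriedAction C M).flip.obj m).map_smul _ _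

theorem epi_actionHomLeft {X Y : C} (f : X ⟶ Y) [Epi f] (m : M) : Epi (f ⊵ₗ m) :=
  have := IsModuleCategory.preservesFiniteColimits_left k (C := C) m
  inferInstanceAs (Epi (((curriedAction C M).flip.obj m).map f))

theorem epi_actionHomRight (X : C) {m n : M} (f : m ⟶ n) [Epi f] : Epi (X ⊴ₗ f) :=
  have := IsModuleCategory.preservesFiniteColimits_right k (M := M) X
  inferInstanceAs (Epi (((curriedAction C M).obj X).map f))

theorem exists_desc_action {X Y : C} (f : X ⟶ Y) (m n : M) (y : Y ⊙ₗ m ⟶ n)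
    (h : f ⊵ₗ m ≫ y = 0) : ∃ z : cokernel f ⊙ₗ m ⟶ n, cokernel.π f ⊵ₗ m ≫ z = y := by
  have := IsModuleCategory.preservesFiniteColimits_left k (C := C) m
  have := IsModuleCategory.additive_left k (C := C) m
  let F := (curriedAction C M).flip.obj m
  have hc := CokernelCofork.mapIsColimit _ (cokernelIsCokernel f) F
  obtain ⟨z, hz⟩ := CokernelCofork.IsColimit.desc' hc y h
  exact ⟨z, hz⟩

/-- The action `X ⊙ₗ m ⟶ n` of a morphism, bilinearly. -/
def precompAction {X Y : C} (m n : M) : (X ⟶ Y) →ₗ[k] (Y ⊙ₗ m ⟶ n) →ₗ[k] (X ⊙ₗ m ⟶ n) :=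
  LinearMap.mk₂ k (fun f x => f ⊵ₗ m ≫ x)
    (fun f g x => by rw [actionHomLeft_add k, Preadditive.add_comp])
    (fun r f x => by rw [actionHomLeft_smul k, Linear.smul_comp])
    (fun f x y => Preadditive.comp_add _ _ _ _ _ _)
    (fun r f x => Linear.comp_smul _ _ _ _ _ _)

variable [IsFiniteLinear k C]

/-- Right exactness of `- ▷ m` makes `X ↦ Hom(X ▷ m, n)` take cokernels to kernels. -/
theorem nonempty_iHom (m n : M) : Nonempty (IHom C m n) := by
  have : ∀ X : C, Module.Finite k (X ⊙ₗ m ⟶ n) := fun X =>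
    (IsModuleCategory.toIsFiniteLinear (C := C)).finite_hom _ _
  obtain ⟨R, u, hu⟩ := exists_representing (k := k) (fun X : C => (X ⊙ₗ m ⟶ n))
    (precompAction k m n) (fun x => by simp [precompAction])
    (fun f g x => by simp [precompAction])
    (fun f y hy => exists_desc_action k f m n y hy)
  refine ⟨⟨R, fun X => Equiv.ofBijective (fun h => h ⊵ₗ m ≫ u) ⟨fun a b hab => ?_, fun x => ?_⟩,
    fun h a => ?_⟩⟩
  · exact (hu X _).unique hab rfl
  · exact (hu X x).exists
  · change (h ≫ a) ⊵ₗ m ≫ u = h ⊵ₗ m ≫ a ⊵ₗ m ≫ u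
    rw [comp_actionHomLeft, Category.assoc]

end Existence

section

variable {C : Type*} [Category* C] [MonoidalCategory C] {M : Type*} [Category* M]
  [MonoidalLeftAction C M]

theorem halfBraiding_actionHomLeft {D E E' : C} (σ : HalfBraiding D) (f : E' ⟶ E) {m n : M}
    (z : E ⊙ₗ D ⊙ₗ m ⟶ n) :
    (σ.β E').hom ⊵ₗ m ≫ (αₗ E' D m).hom ≫ f ⊵ₗ (D ⊙ₗ m) ≫ z =
      (D ◁ f) ⊵ₗ m ≫ (σ.β E).hom ⊵ₗ m ≫ (αₗ E D m).hom ≫ z := by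
  rw [← comp_actionHomLeft_assoc, σ.naturality f, comp_actionHomLeft_assoc]
  simp

theorem associator_actionHomLeft {D E E' : C} (f : E' ⟶ E) {m n : M} (z : E ⊙ₗ m ⟶ n) :
    (αₗ D E' m).hom ≫ D ⊴ₗ (f ⊵ₗ m ≫ z) = (D ◁ f) ⊵ₗ m ≫ (αₗ D E m).hom ≫ D ⊴ₗ z := by
  simp

end

section ExistenceEnd

open Act Limits

variable {k : Type*} [Field k] {V : Type*} [Category* V] {C : Type*} [Category* C]
  [MonoidalCategory C] (G : V ⥤ Center C) (M : Type*) [Category* M] [MonoidalLeftAction C M]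

theorem slides_iff_app {E : C} (z : (⟨E⟩ : Act C M) ⟶ 𝟙_ (Act C M)) :
    Slides G z ↔ ∀ (v : V) (m : M), ((G.obj v).2.β E).hom ⊵ₗ m ≫ (αₗ E (G.obj v).1 m).hom ≫
        z.app _ ≫ (λₗ _).hom =
      (αₗ (G.obj v).1 E m).hom ≫ (G.obj v).1 ⊴ₗ (z.app m ≫ (λₗ m).hom) := by
  refine forall_congr' fun v => ?_
  rw [hb_unit, ← cancel_mono (λ_ (⟨(G.obj v).1⟩ : Act C M)).hom]
  simp only [Category.assoc, Iso.inv_hom_id, Category.comp_id]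
  have h : ∀ m, Act.Hom.app (hb (G.obj v) ⟨E⟩ ≫ z ▷ ⟨(G.obj v).1⟩ ≫ (λ_ _).hom) m =
      ((G.obj v).2.β E).hom ⊵ₗ m ≫ (αₗ E (G.obj v).1 m).hom ≫ z.app _ ≫ (λₗ _).hom := fun m => by
    simp [hb]
  have h' : ∀ m, Act.Hom.app ((⟨(G.obj v).1⟩ : Act C M) ◁ z ≫ (ρ_ _).hom) m =
      (αₗ (G.obj v).1 E m).hom ≫ (G.obj v).1 ⊴ₗ (z.app m ≫ (λₗ m).hom) := fun m => by
    simp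
  constructor
  · intro hz m
    rw [← h, ← h', hz]
  · intro hz
    ext m
    rw [h, h', hz]

variable [Abelian C] [Linear k C] [Abelian M] [Linear k M] [IsModuleCategory k C M]

variable (k) in
/-- The space of natural families `E ⊙ₗ m ⟶ m` compatible with the half-braidings of `G`. -/
def slidingFamilies (E : C) : Submodule k (∀ m : M, E ⊙ₗ m ⟶ m) where
  carrier := {z | (∀ {m n : M} (f : m ⟶ n), E ⊴ₗ f ≫ z n = z m ≫ f) ∧
    ∀ (v : V) (m : M), ((G.obj v).2.β E).hom ⊵ₗ m ≫ (αₗ E (G.obj v).1 m).hom ≫ z _ =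
      (αₗ (G.obj v).1 E m).hom ≫ (G.obj v).1 ⊴ₗ z m}
  add_mem' {z w} hz hw := by
    refine ⟨fun f => ?_, fun v m => ?_⟩
    · simp [hz.1, hw.1]
    · simp only [Pi.add_apply, Preadditive.comp_add, actionHomRight_add k, hz.2, hw.2]
  zero_mem' := by
    refine ⟨fun f => ?_, fun v m => ?_⟩
    · simp
    · simp only [Pi.zero_apply, actionHomRight_zero k, comp_zero]
  smul_mem' r z hz := by
    refine ⟨fun f => ?_, fun v m => ?_⟩
    · simp [hz.1]
    · simp only [Pi.smul_apply, Linear.comp_smul, actionHomRight_smul k, hz.2]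

variable {G M} in
theorem slidingFamilies_precomp {E E' : C} (f : E' ⟶ E) {z : ∀ m : M, E ⊙ₗ m ⟶ m}
    (hz : z ∈ slidingFamilies k G M E) :
    (fun m => f ⊵ₗ m ≫ z m) ∈ slidingFamilies k G M E' := by
  refine ⟨fun g => ?_, fun v m => ?_⟩
  · rw [action_exchange_assoc, hz.1 g, Category.assoc]
  · exact (halfBraiding_actionHomLeft (G.obj v).2 f (z _)).trans
      ((congrArg (fun t => (_ ◁ f) ⊵ₗ m ≫ t) (hz.2 v m)).trans
        (associator_actionHomLeft f (z m)).symm)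

variable (k) in
/-- Precomposition of sliding families with morphisms of `C`, bilinearly. -/
def slidingFamiliesMap {E E' : C} : (E' ⟶ E) →ₗ[k]
    slidingFamilies k G M E →ₗ[k] slidingFamilies k G M E' :=
  LinearMap.mk₂ k (fun f z => ⟨fun m => f ⊵ₗ m ≫ z.1 m, slidingFamilies_precomp f z.2⟩)
    (fun f g z => Subtype.ext (funext fun m => by
      simp [actionHomLeft_add k]))
    (fun r f z => Subtype.ext (funext fun m => by
      simp [actionHomLeft_smul k]))
    (fun f z w => Subtype.ext (funext fun m => by simp))
    (fun r f z => Subtype.ext (funext fun m => by simp))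

attribute [local instance] Abelian.hasFiniteBiproducts

/-- A natural family is determined by its component at a projective separator `Q`: every `m` is a
quotient of some `Q^n`, and `E ▷ -` preserves epimorphisms. -/
theorem finite_slidingFamilies (E : C) : Module.Finite k (slidingFamilies k G M E) := by
  have : IsFiniteLinear k M := IsModuleCategory.toIsFiniteLinear (C := C)
  obtain ⟨Q, hQ, sep⟩ := exists_projective_separator k M
  have := IsFiniteLinear.finite_hom (k := k) (E ⊙ₗ Q) Q
  let ev : slidingFamilies k G M E →ₗ[k] (E ⊙ₗ Q ⟶ Q) :=
    (LinearMap.proj (φ := fun m : M => (E ⊙ₗ m ⟶ m)) Q).comp (slidingFamilies k G M E).subtype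
  refine Module.Finite.of_injective ev ((injective_iff_map_eq_zero _).2 fun z hz => ?_)
  have hz : z.1 Q = 0 := hz
  refine Subtype.ext (funext fun m => ?_)
  obtain ⟨n, p, hp⟩ := exists_epi_of_separator k sep m
  have h1 : z.1 (⨁ fun _ : Fin n => Q) = 0 := biproduct.hom_ext _ _ fun i => by
    rw [← z.2.1, hz, comp_zero, zero_comp]
  have := epi_actionHomRight k E p
  have h2 := z.2.1 p
  rw [h1, zero_comp] at h2
  exact zero_of_epi_comp _ h2

/-- Each component descends to the cokernel by exactness of the action. Naturality and sliding
descend as well, since the actions of `cokernel.π f` are epimorphisms and can be cancelled. -/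
theorem exists_desc_slidingFamilies {X Y : C} (f : X ⟶ Y) (y : slidingFamilies k G M Y)
    (hy : slidingFamiliesMap k G M f y = 0) :
    ∃ z, slidingFamiliesMap k G M (cokernel.π f) z = y := by
  choose z hz using fun m => exists_desc_action k f m m (y.1 m)
    (congrFun (congrArg Subtype.val hy) m)
  refine ⟨⟨z, fun {m n} g => ?_, fun v m => ?_⟩, Subtype.ext (funext hz)⟩
  · have := epi_actionHomLeft k (cokernel.π f) m
    rw [← cancel_epi (cokernel.π f ⊵ₗ m), ← action_exchange_assoc, hz, y.2.1, reassoc_of% hz]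
  · have := epi_actionHomLeft k (cokernel.π f) m
    have := epi_actionHomRight k (G.obj v).1 (cokernel.π f ⊵ₗ m)
    have : Epi (((G.obj v).1 ◁ cokernel.π f) ⊵ₗ m) := by
      rw [whiskerLeft_actionHomLeft]
      infer_instance
    refine (cancel_epi (((G.obj v).1 ◁ cokernel.π f) ⊵ₗ m)).1 ?_
    refine (halfBraiding_actionHomLeft (G.obj v).2 _ (z _)).symm.trans
      (Eq.trans ?_ (associator_actionHomLeft _ (z m)))
    rw [hz, hz]
    exact y.2.2 v m

theorem exists_isUniversal [IsFiniteLinear k C] :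
    ∃ (A : C) (e : (⟨A⟩ : Act C M) ⟶ 𝟙_ (Act C M)), IsUniversal G A e := by
  have := finite_slidingFamilies (k := k) G M
  obtain ⟨A, u, hu⟩ := exists_representing (k := k) (fun E : C => slidingFamilies k G M E)
    (slidingFamiliesMap k G M) (fun x => Subtype.ext (funext fun m => by
      simp [slidingFamiliesMap])) (fun f g x => Subtype.ext (funext fun m => by
      simp [slidingFamiliesMap])) (exists_desc_slidingFamilies G M)
  refine ⟨A, ofFamily u.1 u.2.1, (slides_iff_app G M _).2 ?_, fun E z hz => ?_⟩
  · simpa [ofFamily] using u.2.2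
  · have hz' := (slides_iff_app G M _).1 hz
    have key : ∀ h : E ⟶ A, tr M h ≫ ofFamily u.1 u.2.1 = z ↔ slidingFamiliesMap k G M h u =
        ⟨fun m => z.app m ≫ (λₗ m).hom, fun {m n} f => by
          have := z.naturality f
          rw [reassoc_of% this]
          simp, hz'⟩ := fun h => by
      constructor
      · rintro rfl
        refine Subtype.ext (funext fun m => ?_)
        simp [slidingFamiliesMap, ofFamily]
      · intro hh
        ext m
        have := congrFun (congrArg Subtype.val hh) m
        simp only [slidingFamiliesMap, LinearMap.mk₂_apply] at this
        rw [← cancel_mono (λₗ m).hom, ← this]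
        simp [ofFamily]
    simp only [key]
    exact hu E _

end ExistenceEnd

/-! ### Module categories of right modules -/

section Transfer

open Functor.LaxLeftLinear Functor.OplaxLeftLinear

variable {C : Type*} [Category* C] [MonoidalCategory C]

/-- A natural family `Z ⊙ₗ n ⟶ n` that is compatible with a half-braiding on `Z`. -/
structure IsActingFamily {N : Type*} [Category* N] [MonoidalLeftAction C N] {Z : C}
    (σ : HalfBraiding Z) (z : ∀ n : N, Z ⊙ₗ n ⟶ n) : Prop where
  natural : ∀ {m n : N} (f : m ⟶ n), Z ⊴ₗ f ≫ z n = z m ≫ f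
  compat : ∀ (X : C) (m : N), (αₗ Z X m).hom ≫ z (X ⊙ₗ m) =
    (σ.β X).hom ⊵ₗ m ≫ (αₗ X Z m).hom ≫ X ⊴ₗ z m

variable {N N' : Type*} [Category* N] [MonoidalLeftAction C N] [Category* N']
  [MonoidalLeftAction C N'] (Φ : N ⥤ N') [Φ.LeftLinear C] {Z : C} {σ : HalfBraiding Z}

/-- Fullness writes `a` as the image of a morphism `X ▷ m ⟶ n`, to which naturality applies; the
compatibility at `X` then expresses `z` at `X ▷ m` through `z` at `m`. -/
theorem IsActingFamily.map_naturality [Φ.Full] {z : ∀ n : N, Z ⊙ₗ n ⟶ n}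
    (hz : IsActingFamily σ z) {X : C} {m n : N} (a : X ⊙ₗ Φ.obj m ⟶ Φ.obj n) :
    (αₗ Z X (Φ.obj m)).hom ≫ Z ⊴ₗ a ≫ μₗ Φ Z n ≫ Φ.map (z n) =
      (σ.β X).hom ⊵ₗ Φ.obj m ≫ (αₗ X Z (Φ.obj m)).hom ≫
        X ⊴ₗ (μₗ Φ Z m ≫ Φ.map (z m)) ≫ a := by
  obtain ⟨g, rfl⟩ : ∃ g, a = μₗ Φ X m ≫ Φ.map g :=
    ⟨Φ.preimage (δₗ Φ X m ≫ a), by simp⟩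
  have h := congrArg Φ.map (hz.compat X m)
  rw [Φ.map_comp, Φ.map_comp, Φ.map_comp] at h
  have h1 : (αₗ Z X (Φ.obj m)).hom ≫ Z ⊴ₗ μₗ Φ X m ≫ μₗ Φ Z (X ⊙ₗ m) ≫ Φ.map (z (X ⊙ₗ m)) =
      (σ.β X).hom ⊵ₗ Φ.obj m ≫ (αₗ X Z (Φ.obj m)).hom ≫
        X ⊴ₗ (μₗ Φ Z m ≫ Φ.map (z m)) ≫ μₗ Φ X m := by
    rw [← μₗ_associativity_assoc, h, ← μₗ_naturality_left_assoc, μₗ_associativity_assoc,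
      ← μₗ_naturality_right, actionHomRight_comp, Category.assoc]
  rw [actionHomRight_comp, Category.assoc, μₗ_naturality_right_assoc, ← Φ.map_comp, hz.natural,
    Φ.map_comp, reassoc_of% h1]

theorem IsActingFamily.exists_preimage [Φ.Full] [Φ.Faithful] {z' : ∀ n : N', Z ⊙ₗ n ⟶ n}
    (hz : IsActingFamily σ z') : ∃ z : ∀ n : N, Z ⊙ₗ n ⟶ n, IsActingFamily σ z ∧
      ∀ n, μₗ Φ Z n ≫ Φ.map (z n) = z' (Φ.obj n) := by
  have h : ∀ n, μₗ Φ Z n ≫ Φ.map (Φ.preimage (δₗ Φ Z n ≫ z' (Φ.obj n))) = z' (Φ.obj n) :=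
    fun n => by simp
  refine ⟨fun n => Φ.preimage (δₗ Φ Z n ≫ z' (Φ.obj n)), ⟨fun f => ?_, fun X m => ?_⟩, h⟩
  · refine Φ.map_injective ?_
    rw [← cancel_epi (Functor.LeftLinear.μₗIso Φ Z _).hom]
    dsimp only [Functor.LeftLinear.μₗIso]
    rw [Φ.map_comp, Φ.map_comp, ← μₗ_naturality_right_assoc, h, hz.natural, reassoc_of% h]
  · refine Φ.map_injective ?_
    rw [← cancel_epi (Functor.LeftLinear.μₗIso Φ (Z ⊗ X) _).hom]
    dsimp only [Functor.LeftLinear.μₗIso]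
    rw [Φ.map_comp, Φ.map_comp, Φ.map_comp, μₗ_associativity_assoc, h, hz.natural,
      reassoc_of% hz.compat, ← μₗ_naturality_left_assoc, μₗ_associativity_assoc,
      ← μₗ_naturality_right, ← actionHomRight_comp_assoc, h]

end Transfer

/-! ### Acting families on right modules and centralizing morphisms -/

namespace RightMod

variable {C : Type*} [Category* C] [MonoidalCategory C] {B : C} [MonObj B]

variable (B) in
/-- The regular right module. -/
@[simps]
def regular : RightMod B where
  X := B
  act := MonObj.mul
  act_one := MonObj.mul_one B
  act_mul := MonObj.mul_assoc B

/-- The action of `B` on `P`, as a morphism from the free module on `P.X`. -/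
def actHom (P : RightMod B) : P.X ⊙ₗ regular B ⟶ P where
  hom := P.act
  comm := (Category.assoc _ _ _).trans P.act_mul.symm

theorem act_unit_naturality {Z : C} (σ : HalfBraiding Z) :
    (ρ_ Z).inv ≫ Z ◁ MonObj.one (X := B) ≫ (σ.β B).hom = (λ_ Z).inv ≫ MonObj.one ▷ Z := by
  rw [σ.naturality, halfBraiding_unit]
  simp

/-- The morphism `Z ⊗ P ⟶ P` induced by `ζ : Z ⟶ B` and a half-braiding on `Z`. -/
def slideAct {Z : C} (σ : HalfBraiding Z) (ζ : Z ⟶ B) (P : RightMod B) : Z ⊗ P.X ⟶ P.X :=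
  (σ.β P.X).hom ≫ P.X ◁ ζ ≫ P.act

/-- Acting on the unit of the regular module recovers `ζ`; this gives injectivity of `ζ ↦ z`. -/
theorem unit_comp_slideAct_regular {Z : C} (σ : HalfBraiding Z) (ζ : Z ⟶ B) :
    (ρ_ Z).inv ≫ Z ◁ (MonObj.one : 𝟙_ C ⟶ B) ≫ slideAct σ ζ (regular B) = ζ := by
  change (ρ_ Z).inv ≫ Z ◁ MonObj.one ≫ (σ.β B).hom ≫ B ◁ ζ ≫ MonObj.mul = ζ
  rw [reassoc_of% act_unit_naturality (B := B) σ, ← whisker_exchange_assoc, MonObj.one_mul]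
  simp

/-- The centralizing condition is what lets `ζ` pass the extra factor `B`, making the induced action
`B`-linear. -/
theorem slideAct_comm {Z : C} {σ : HalfBraiding Z} {ζ : Z ⟶ B}
    (h : ζ ▷ B ≫ MonObj.mul = (σ.β B).hom ≫ B ◁ ζ ≫ MonObj.mul) (P : RightMod B) :
    ((α_ Z P.X B).hom ≫ Z ◁ P.act) ≫ slideAct σ ζ P = slideAct σ ζ P ▷ B ≫ P.act := by
  have h' := congrArg (fun t => P.X ◁ t) h
  simp only [MonoidalCategory.whiskerLeft_comp] at h'
  simp only [slideAct, Category.assoc, comp_whiskerRight]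
  rw [σ.naturality_assoc, σ.monoidal, ← whisker_exchange_assoc, P.act_mul]
  simp [← reassoc_of% h']

theorem slideAct_naturality {Z : C} (σ : HalfBraiding Z) (ζ : Z ⟶ B) {P Q : RightMod B}
    (f : P ⟶ Q) : Z ◁ f.hom ≫ slideAct σ ζ Q = slideAct σ ζ P ≫ f.hom := by
  simp only [slideAct, Category.assoc, f.comm]
  rw [σ.naturality_assoc, ← whisker_exchange_assoc]

theorem isActingFamily_slideAct {Z : C} {σ : HalfBraiding Z} {ζ : Z ⟶ B}
    (h : ζ ▷ B ≫ MonObj.mul = (σ.β B).hom ≫ B ◁ ζ ≫ MonObj.mul) :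
    IsActingFamily σ (fun P : RightMod B =>
      (⟨slideAct σ ζ P, slideAct_comm h P⟩ : Z ⊙ₗ P ⟶ P)) where
  natural f := hom_ext _ _ (slideAct_naturality σ ζ f)
  compat X P := hom_ext _ _ (by
    change (α_ Z X P.X).hom ≫ (σ.β (X ⊗ P.X)).hom ≫ (X ⊗ P.X) ◁ ζ ≫ (α_ X P.X B).hom ≫ X ◁ P.act =
      (σ.β X).hom ▷ P.X ≫ (α_ X Z P.X).hom ≫ X ◁ ((σ.β P.X).hom ≫ P.X ◁ ζ ≫ P.act)
    rw [σ.monoidal]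
    simp)

end RightMod

section Relates

open Functor.LaxLeftLinear Functor.OplaxLeftLinear RightMod

variable {C : Type*} [Category* C] [MonoidalCategory C] {B : C} [MonObj B]
  {M : Type*} [Category* M] [MonoidalLeftAction C M] (Φ : M ⥤ RightMod B) [Φ.LeftLinear C]

/-- Under `Φ`, the family `z` is the one induced by `ζ : Z ⟶ B`. -/
def Relates {Z : C} (σ : HalfBraiding Z) (z : ∀ m : M, Z ⊙ₗ m ⟶ m) (ζ : Z ⟶ B) : Prop :=
  ∀ m, (μₗ Φ Z m ≫ Φ.map (z m)).hom = slideAct σ ζ (Φ.obj m)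

variable {Φ}

theorem exists_relates_of_compat [Φ.Full] [Φ.Faithful] {Z : C} {σ : HalfBraiding Z} {ζ : Z ⟶ B}
    (h : ζ ▷ B ≫ MonObj.mul = (σ.β B).hom ≫ B ◁ ζ ≫ MonObj.mul) :
    ∃ z : ∀ m : M, Z ⊙ₗ m ⟶ m, IsActingFamily σ z ∧ Relates Φ σ z ζ := by
  obtain ⟨z, hz, h'⟩ := (isActingFamily_slideAct h).exists_preimage Φ
  exact ⟨z, hz, fun m => congrArg Hom.hom (h' m)⟩

theorem Relates.unique_left [Φ.Faithful] {Z : C} {σ : HalfBraiding Z} {z w : ∀ m : M, Z ⊙ₗ m ⟶ m}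
    {ζ : Z ⟶ B} (hz : Relates Φ σ z ζ) (hw : Relates Φ σ w ζ) (m : M) : z m = w m := by
  refine Φ.map_injective ?_
  rw [← cancel_epi (Functor.LeftLinear.μₗIso Φ Z m).hom]
  exact hom_ext _ _ ((hz m).trans (hw m).symm)

theorem Relates.unique_right [Φ.EssSurj] {Z : C} {σ : HalfBraiding Z} {z : ∀ m : M, Z ⊙ₗ m ⟶ m}
    {ζ ξ : Z ⟶ B} (hζ : Relates Φ σ z ζ) (hξ : Relates Φ σ z ξ) : ζ = ξ := by
  have h := (hζ (Φ.objPreimage (regular B))).symm.trans (hξ _)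
  let i := Φ.objObjPreimageIso (regular B)
  have hi : ∀ t, slideAct σ t (regular B) = Z ◁ i.inv.hom ≫ slideAct σ t (Φ.obj _) ≫ i.hom.hom :=
    fun t => by
      rw [← slideAct_naturality, ← MonoidalCategory.whiskerLeft_comp_assoc, ← RightMod.comp_hom,
        i.inv_hom_id, id_hom, MonoidalCategory.whiskerLeft_id, Category.id_comp]
  rw [← unit_comp_slideAct_regular σ ζ, ← unit_comp_slideAct_regular σ ξ, hi ζ, hi ξ, h]

theorem Relates.precomp {Z Z' : Center C} (f : Z ⟶ Z') {z : ∀ m : M, Z'.1 ⊙ₗ m ⟶ m} {ζ : Z'.1 ⟶ B}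
    (h : Relates Φ Z'.2 z ζ) : Relates Φ Z.2 (fun m => f.f ⊵ₗ m ≫ z m) (f.f ≫ ζ) := fun m => by
  rw [Φ.map_comp, ← μₗ_naturality_left_assoc, RightMod.comp_hom, h m]
  change f.f ▷ _ ≫ (Z'.2.β _).hom ≫ _ ≫ _ = (Z.2.β _).hom ≫ _ ◁ (f.f ≫ ζ) ≫ _
  rw [MonoidalCategory.whiskerLeft_comp_assoc]
  exact (Category.assoc _ _ _).symm.trans ((congrArg (· ≫ _) (f.comm _)).trans
    (Category.assoc _ _ _))

/-- The correspondence between `z` and `ζ` is natural in `Z` and injective both ways, so pairs of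
either kind have the same morphisms. -/
theorem Relates.comp_eq_iff [Φ.Faithful] [Φ.EssSurj] {Z Z' : Center C} (f : Z ⟶ Z')
    {z : ∀ m : M, Z.1 ⊙ₗ m ⟶ m} {z' : ∀ m : M, Z'.1 ⊙ₗ m ⟶ m} {ζ : Z.1 ⟶ B} {ζ' : Z'.1 ⟶ B}
    (h : Relates Φ Z.2 z ζ) (h' : Relates Φ Z'.2 z' ζ') :
    (∀ m, f.f ⊵ₗ m ≫ z' m = z m) ↔ f.f ≫ ζ' = ζ := by
  constructor
  · intro hf
    have := h'.precomp f
    rw [funext hf] at this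
    exact this.unique_right h
  · rintro rfl m
    exact (h'.precomp f).unique_left h m

/-- The component `r` at the regular module is `B`-linear, hence left multiplication by its value
`ζ` on the unit. Every module `P` receives the `B`-linear action map from `P.X ⊗ B`, so `r`
determines the whole family. -/
theorem IsActingFamily.exists_relates [Φ.Full] [Φ.EssSurj] {Z : C} {σ : HalfBraiding Z}
    {z : ∀ m : M, Z ⊙ₗ m ⟶ m} (hz : IsActingFamily σ z) :
    ∃ ζ : Z ⟶ B, Relates Φ σ z ζ ∧
      ζ ▷ B ≫ MonObj.mul = (σ.β B).hom ≫ B ◁ ζ ≫ MonObj.mul := by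
  let i := Φ.objObjPreimageIso (regular B)
  let r : Z ⊙ₗ regular B ⟶ regular B :=
    Z ⊴ₗ i.inv ≫ (μₗ Φ Z _ ≫ Φ.map (z (Φ.objPreimage (regular B)))) ≫ i.hom
  -- Naturality along the action map, read through the isomorphism of the regular module with an
  -- object in the image of `Φ`.
  have key : ∀ m, Z ◁ (Φ.obj m).act ≫ (μₗ Φ Z m ≫ Φ.map (z m)).hom =
      (α_ _ _ _).inv ≫ (σ.β (Φ.obj m).X).hom ▷ B ≫ (α_ _ _ _).hom ≫
        (Φ.obj m).X ◁ r.hom ≫ (Φ.obj m).act := fun m => by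
    have h := hz.map_naturality Φ ((Φ.obj m).X ⊴ₗ i.hom ≫ actHom (Φ.obj m))
    have h1 : (αₗ Z (Φ.obj m).X (regular B)).hom ≫ Z ⊴ₗ actHom (Φ.obj m) ≫ μₗ Φ Z m ≫ Φ.map (z m) =
      (σ.β (Φ.obj m).X).hom ⊵ₗ regular B ≫ (αₗ (Φ.obj m).X Z (regular B)).hom ≫
        (Φ.obj m).X ⊴ₗ r ≫ actHom (Φ.obj m) := by
      have h2 : (Z ⊗ (Φ.obj m).X) ⊴ₗ i.inv ≫ (αₗ _ _ _).hom ≫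
          Z ⊴ₗ ((Φ.obj m).X ⊴ₗ i.hom ≫ actHom (Φ.obj m)) =
          (αₗ _ _ _).hom ≫ Z ⊴ₗ actHom (Φ.obj m) := by
        rw [tensor_actionHomRight_assoc, Iso.inv_hom_id_assoc, ← actionHomRight_comp,
          ← actionHomRight_comp_assoc, i.inv_hom_id, actionHomRight_id, Category.id_comp]
      rw [← reassoc_of% h2, h, action_exchange_assoc, tensor_actionHomRight_assoc,
        Iso.inv_hom_id_assoc]
      simp only [r, actionHomRight_comp, Category.assoc]
    have h3 := congrArg Hom.hom h1
    rw [Iso.eq_inv_comp]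
    exact h3
  obtain ⟨r', hr'⟩ : ∃ r' : Z ⊗ B ⟶ B, r' = r.hom := ⟨_, rfl⟩
  have hr : ((ρ_ Z).inv ≫ Z ◁ MonObj.one ≫ r') ▷ B ≫ MonObj.mul = r' := by
    have h : ((α_ Z B B).hom ≫ Z ◁ MonObj.mul) ≫ r' = r' ▷ B ≫ MonObj.mul := by
      rw [hr']
      exact r.comm
    rw [comp_whiskerRight, comp_whiskerRight, Category.assoc, Category.assoc, ← h]
    simp [← MonoidalCategory.whiskerLeft_comp_assoc]
  have hrel : Relates Φ σ z ((ρ_ Z).inv ≫ Z ◁ MonObj.one ≫ r') := fun m => by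
    obtain ⟨t, ht⟩ : ∃ t : Z ⊗ (Φ.obj m).X ⟶ (Φ.obj m).X, t = (μₗ Φ Z m ≫ Φ.map (z m)).hom :=
      ⟨_, rfl⟩
    have h : Z ◁ (Φ.obj m).act ≫ t = (α_ _ _ _).inv ≫ (σ.β (Φ.obj m).X).hom ▷ B ≫
        (α_ _ _ _).hom ≫ (Φ.obj m).X ◁ r' ≫ (Φ.obj m).act := by
      rw [ht, hr']
      exact key m
    refine ht.symm.trans ?_
    -- The action map is split by the unit of `B`, which lets `h` be solved for `t`.
    have h' : Z ◁ (ρ_ _).inv ≫ Z ◁ (Φ.obj m).X ◁ MonObj.one ≫ Z ◁ (Φ.obj m).act = 𝟙 _ := by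
      rw [← MonoidalCategory.whiskerLeft_comp, (Φ.obj m).act_one,
        ← MonoidalCategory.whiskerLeft_comp, Iso.inv_hom_id, MonoidalCategory.whiskerLeft_id]
    rw [← Category.id_comp t, ← h', Category.assoc, Category.assoc, h, slideAct,
      associator_inv_naturality_right_assoc, whisker_exchange_assoc]
    simp
  refine ⟨_, hrel, ?_⟩
  -- The centralizing equation compares two descriptions of `r`: left multiplication by `ζ`, from
  -- `B`-linearity, and `slideAct`, from `hrel` at the regular module.
  refine hr.trans (hr'.trans ?_)
  have h := hrel (Φ.objPreimage (regular B))
  change (Z ◁ i.inv.hom ≫ (μₗ Φ Z _ ≫ Φ.map (z (Φ.objPreimage (regular B)))).hom ≫ i.hom.hom) = _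
  rw [h, ← slideAct_naturality, ← MonoidalCategory.whiskerLeft_comp_assoc, ← RightMod.comp_hom,
    i.inv_hom_id, id_hom, MonoidalCategory.whiskerLeft_id, Category.id_comp]
  rfl


/-! ### The relative end as a Laugwitz–Walton algebra -/

/-- Acting twice corresponds to multiplying two copies of `ζ` in `B`. Together with `relates_one`,
this makes `ζ` an algebra morphism as soon as the multiplication and unit of `Z` act correctly. -/
theorem Relates.tensor {Z : Center C} {z : ∀ m : M, Z.1 ⊙ₗ m ⟶ m} {ζ : Z.1 ⟶ B}
    (h : Relates Φ Z.2 z ζ) (hζ : ζ ▷ B ≫ MonObj.mul = (Z.2.β B).hom ≫ B ◁ ζ ≫ MonObj.mul) :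
    Relates Φ (Z ⊗ Z).2 (fun m => (αₗ Z.1 Z.1 m).hom ≫ Z.1 ⊴ₗ z m ≫ z m)
      ((ζ ⊗ₘ ζ) ≫ MonObj.mul : Z.1 ⊗ Z.1 ⟶ B) := fun m => by
  have h1 : μₗ Φ (Z.1 ⊗ Z.1) m ≫ Φ.map ((αₗ Z.1 Z.1 m).hom ≫ Z.1 ⊴ₗ z m ≫ z m) =
      (αₗ Z.1 Z.1 (Φ.obj m)).hom ≫ Z.1 ⊴ₗ (μₗ Φ Z.1 m ≫ Φ.map (z m)) ≫
        (μₗ Φ Z.1 m ≫ Φ.map (z m)) := by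
    rw [Φ.map_comp, Φ.map_comp, μₗ_associativity_assoc, ← μₗ_naturality_right_assoc,
      actionHomRight_comp, Category.assoc]
  refine (congrArg Hom.hom h1).trans ?_
  change (α_ Z.1 Z.1 (Φ.obj m).X).hom ≫ Z.1 ◁ (μₗ Φ Z.1 m ≫ Φ.map (z m)).hom ≫
    (μₗ Φ Z.1 m ≫ Φ.map (z m)).hom =
    ((α_ _ _ _).hom ≫ Z.1 ◁ (Z.2.β _).hom ≫ (α_ _ _ _).inv ≫ (Z.2.β _).hom ▷ Z.1 ≫
      (α_ _ _ _).hom) ≫ (Φ.obj m).X ◁ ((ζ ⊗ₘ ζ) ≫ MonObj.mul) ≫ (Φ.obj m).act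
  obtain ⟨t, ht⟩ : ∃ t : Z.1 ⊗ (Φ.obj m).X ⟶ (Φ.obj m).X, t = (μₗ Φ Z.1 m ≫ Φ.map (z m)).hom :=
    ⟨_, rfl⟩
  have h2 : t = slideAct Z.2 ζ (Φ.obj m) := ht.trans (h m)
  refine (congrArg (fun s => (α_ Z.1 Z.1 (Φ.obj m).X).hom ≫ Z.1 ◁ s ≫ s)
    (ht.symm.trans h2)).trans ?_
  have h3 := slideAct_comm hζ (Φ.obj m)
  rw [Category.assoc, ← Iso.eq_inv_comp] at h3
  rw [slideAct, MonoidalCategory.whiskerLeft_comp, MonoidalCategory.whiskerLeft_comp]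
  simp only [Category.assoc]
  rw [← slideAct, h3, associator_inv_naturality_right_assoc, whisker_exchange_assoc, slideAct]
  simp only [comp_whiskerRight, Category.assoc]
  rw [← whisker_exchange_assoc, (Φ.obj m).act_mul]
  simp [MonoidalCategory.tensorHom_def]

theorem relates_one : Relates Φ (𝟙_ (Center C)).2 (fun m => (λₗ m).hom)
    (MonObj.one : 𝟙_ C ⟶ B) := fun m => by
  refine (congrArg Hom.hom (μₗ_unitality Φ (C := C) m).symm).trans ?_
  change (λ_ (Φ.obj m).X).hom = ((λ_ _).hom ≫ (ρ_ _).inv) ≫ (Φ.obj m).X ◁ MonObj.one ≫ (Φ.obj m).act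
  rw [(Φ.obj m).act_one]
  simp

variable {V : Type*} [Category* V] {G : V ⥤ Center C}

/-- A terminal acting pair that acts multiplicatively gives a Laugwitz–Walton algebra. -/
theorem isLaugwitzWalton_of_relates [Φ.IsEquivalence] {A : Center C} [mon : MonObj A]
    (hc : IsRelCentral G A) {e : ∀ m : M, A.1 ⊙ₗ m ⟶ m}
    (hu : ∀ (Z : Center C) (z : ∀ m : M, Z.1 ⊙ₗ m ⟶ m), IsRelCentral G Z → IsActingFamily Z.2 z →
      ∃! f : Z ⟶ A, ∀ m, f.f ⊵ₗ m ≫ e m = z m)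
    (hmul : ∀ m : M, (mon.mul.f : A.1 ⊗ A.1 ⟶ A.1) ⊵ₗ m ≫ e m =
      (αₗ A.1 A.1 m).hom ≫ A.1 ⊴ₗ e m ≫ e m)
    (hone : ∀ m : M, (mon.one.f : 𝟙_ C ⟶ A.1) ⊵ₗ m ≫ e m = (λₗ m).hom)
    {ζ : A.1 ⟶ B} (hζ : ζ ▷ B ≫ MonObj.mul = (A.2.β B).hom ≫ B ◁ ζ ≫ MonObj.mul)
    (h : Relates Φ A.2 e ζ) : IsLaugwitzWalton G B A ζ where
  terminal := by
    -- A centralizing pair yields an acting family on the same `Z`, and `comp_eq_iff` translates the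
    -- unique map for that family.
    have key : ∀ P : CentralizingPair G B, ∃! f : P.Z ⟶ A, f.f ≫ ζ = P.ζ := fun P => by
      obtain ⟨z, hz, hr⟩ := exists_relates_of_compat (Φ := Φ) P.compat
      simpa only [hr.comp_eq_iff _ h] using hu P.Z z P.central hz
    refine ⟨hc, hζ, ⟨Limits.IsTerminal.ofUniqueHom
      (fun P => ⟨(key P).choose, (key P).choose_spec.1⟩) fun P f => ?_⟩⟩
    exact CentralizingPair.Hom.ext ((key P).unique f.comm (key P).choose_spec.1)
  map_mul := (Relates.comp_eq_iff (Z := A ⊗ A) mon.mul (h.tensor hζ) h).1 hmul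
  map_one := (Relates.comp_eq_iff (Z := 𝟙_ _) mon.one relates_one h).1 hone

end Relates

/-! ### Uniqueness of Laugwitz–Walton algebras -/

section Uniqueness

variable {V : Type*} [Category* V] {C : Type*} [Category* C] [MonoidalCategory C]
  {G : V ⥤ Center C} {B : C} [MonObj B]

theorem centralizing_precomp {Z Z' : Center C} (f : Z ⟶ Z') {ζ : Z'.1 ⟶ B}
    (h : ζ ▷ B ≫ MonObj.mul = (Z'.2.β B).hom ≫ B ◁ ζ ≫ MonObj.mul) :
    (f.f ≫ ζ) ▷ B ≫ MonObj.mul = (Z.2.β B).hom ≫ B ◁ (f.f ≫ ζ) ≫ MonObj.mul := by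
  rw [comp_whiskerRight, Category.assoc, h, MonoidalCategory.whiskerLeft_comp, Category.assoc]
  exact (Category.assoc _ _ _).symm.trans ((congrArg (· ≫ _) (f.comm B)).trans
    (Category.assoc _ _ _))

theorem IsLaugwitzWalton.hom_ext {L : Center C} [MonObj L] {ζ : L.1 ⟶ B}
    (h : IsLaugwitzWalton G B L ζ) {Z : Center C} (hZ : IsRelCentral G Z) {f g : Z ⟶ L}
    (hfg : f.f ≫ ζ = g.f ≫ ζ) : f = g := by
  obtain ⟨hL, hζ, ⟨t⟩⟩ := h.terminal
  exact congrArg CentralizingPair.Hom.hom (t.hom_ext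
    (⟨f, rfl⟩ : CentralizingPair.Hom ⟨Z, hZ, f.f ≫ ζ, centralizing_precomp f hζ⟩ ⟨L, hL, ζ, hζ⟩)
    ⟨g, hfg.symm⟩)

/-- Laugwitz–Walton algebras are unique, as algebras over `B`. -/
theorem IsLaugwitzWalton.exists_iso {A L : Center C} [MonObj A] [MonObj L] {ζ : A.1 ⟶ B}
    {ζ' : L.1 ⟶ B} (h : IsLaugwitzWalton G B A ζ) (h' : IsLaugwitzWalton G B L ζ') :
    ∃ i : A ≅ L, IsMonHom i.hom ∧ i.hom.f ≫ ζ' = ζ := by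
  obtain ⟨hA, hζ, ⟨t⟩⟩ := h.terminal
  obtain ⟨hL, hζ', ⟨t'⟩⟩ := h'.terminal
  let j := t.uniqueUpToIso t'
  let i : A ≅ L := ⟨j.hom.hom, j.inv.hom, congrArg CentralizingPair.Hom.hom j.hom_inv_id,
    congrArg CentralizingPair.Hom.hom j.inv_hom_id⟩
  have hi : i.hom.f ≫ ζ' = ζ := j.hom.comm
  -- Morphisms from the relatively central objects `𝟙` and `A ⊗ A` to `L` are determined by their
  -- composites with `ζ'`. Since `ζ` and `ζ'` are algebra morphisms, the composites agree.
  refine ⟨i, ⟨h'.hom_ext isRelCentral_unit ?_, h'.hom_ext (hA.tensor hA) ?_⟩, hi⟩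
  · change ((MonObj.one : 𝟙_ _ ⟶ A).f ≫ i.hom.f) ≫ ζ' = _
    rw [Category.assoc, hi]
    exact h.map_one.trans h'.map_one.symm
  · change ((MonObj.mul : A ⊗ A ⟶ A).f ≫ i.hom.f) ≫ ζ' =
      ((i.hom.f ⊗ₘ i.hom.f) ≫ (MonObj.mul : L ⊗ L ⟶ L).f) ≫ ζ'
    refine (Category.assoc _ _ _).trans ((congrArg (_ ≫ ·) hi).trans (h.map_mul.trans ?_))
    refine Eq.trans ?_ ((congrArg (_ ≫ ·) h'.map_mul.symm).trans (Category.assoc _ _ _).symm)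
    exact (congrArg (fun s => (s ⊗ₘ s) ≫ MonObj.mul) hi.symm).trans
      (tensorHom_comp_tensorHom_assoc _ _ _ _ _).symm

end Uniqueness

/-! ### The relative end as a terminal pair -/

section Terminal

open Act

variable {V : Type*} [Category* V] [MonoidalCategory V] [BraidedCategory V] [RigidCategory V]
  {C : Type*} [Category* C] [MonoidalCategory C]
  {G : V ⥤ Center C} [G.Braided]
  {M : Type*} [Category* M] [MonoidalLeftAction C M] {H : ∀ m n : M, IHom C m n}

theorem isActingFamily_iff {Z : Center C} (z : (⟨Z.1⟩ : Act C M) ⟶ 𝟙_ (Act C M)) :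
    IsActingFamily Z.2 (fun m => z.app m ≫ (λₗ m).hom) ↔ ∀ X : C,
      z ▷ ⟨X⟩ ≫ (λ_ (⟨X⟩ : Act C M)).hom = hb Z ⟨X⟩ ≫ ⟨X⟩ ◁ z ≫ (ρ_ _).hom :=
  ⟨fun h X => (compat_iff z X).1 (h.compat X), fun h => ⟨fun f => by
    have := z.naturality f
    rw [reassoc_of% this]
    simp, fun X => (compat_iff z X).2 (h X)⟩⟩

theorem RelativeEnd.isActingFamily (A : RelativeEnd G H) {σ : HalfBraiding A.obj}
    (hσ : A.IsCanonicalHalfBraiding σ) : IsActingFamily σ A.e := by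
  have h := (isActingFamily_iff (Z := A.center σ) A.eAct).2 fun X =>
    ((A.isCanonicalHalfBraiding_iff σ).1 hσ X).symm
  convert h using 2
  rw [A.eAct_app, Category.assoc, Iso.inv_hom_id, Category.comp_id]

theorem RelativeEnd.existsUnique_center [RigidCategory C] (A : RelativeEnd G H)
    {σ : HalfBraiding A.obj} (hσ : A.IsCanonicalHalfBraiding σ) {Z : Center C}
    {z : ∀ m : M, Z.1 ⊙ₗ m ⟶ m} (hZ : IsRelCentral G Z) (hz : IsActingFamily Z.2 z) :
    ∃! f : Z ⟶ A.center σ, ∀ m, f.f ⊵ₗ m ≫ A.e m = z m := by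
  have hz' : ∀ m, (ofFamily z hz.natural).app m ≫ (λₗ m).hom = z m := fun m => by
    simp [ofFamily]
  have key : ∀ f : Z ⟶ A.center σ, (∀ m, f.f ⊵ₗ m ≫ A.e m = z m) ↔
      tr M f.f ≫ A.eAct = ofFamily z hz.natural := fun f => by
    have h : ∀ m, Act.Hom.app (tr M f.f ≫ A.eAct) m ≫ (λₗ m).hom = f.f ⊵ₗ m ≫ A.e m :=
      fun m => by
        refine (Category.assoc _ _ _).trans (congrArg (f.f ⊵ₗ m ≫ ·) ?_)
        rw [A.eAct_app, Category.assoc, Iso.inv_hom_id, Category.comp_id]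
    constructor
    · intro hf
      refine Act.hom_ext fun m => ?_
      exact (cancel_mono (λₗ m).hom).1 ((h m).trans ((hf m).trans (hz' m).symm))
    · intro hf m
      rw [← h, hf, hz']
  simp only [key]
  refine A.isUniversal.existsUnique_center (A := A.center σ)
    ((A.isCanonicalHalfBraiding_iff σ).1 hσ) hZ ((isActingFamily_iff _).1 ?_)
  simpa only [hz'] using hz

theorem RelativeEnd.existsUnique_isCanonicalHalfBraiding [RigidCategory C]
    (A : RelativeEnd G H) : ∃! σ : HalfBraiding A.obj, A.IsCanonicalHalfBraiding σ := by
  obtain ⟨σ, hσ⟩ := A.isUniversal.exists_halfBraiding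
  exact ⟨σ, (A.isCanonicalHalfBraiding_iff σ).2 hσ, fun τ hτ =>
    A.isUniversal.halfBraiding_ext ((A.isCanonicalHalfBraiding_iff τ).1 hτ) hσ⟩

theorem RelativeEnd.existsUnique_isCanonicalAlgebra [RigidCategory C] (A : RelativeEnd G H)
    {σ : HalfBraiding A.obj} (hσ : A.IsCanonicalHalfBraiding σ) :
    ∃! mon : MonObj (A.center σ), A.IsCanonicalAlgebra σ mon := by
  obtain ⟨mon, h⟩ := A.isUniversal.exists_isActing (A := A.center σ)
    ((A.isCanonicalHalfBraiding_iff σ).1 hσ)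
  exact ⟨mon, (A.isCanonicalAlgebra_iff σ mon).2 h, fun mon' h' =>
    A.isUniversal.isActing_unique (A := A.center σ) ((A.isCanonicalAlgebra_iff σ mon').1 h') h⟩

end Terminal

end RelCenter

end

open RelCenter in
theorem mainTheorem5
    {k : Type*} [Field k] [IsAlgClosed k]
    -- the braided finite tensor category `V`
    {V : Type*} [Category* V] [Abelian V] [Linear k V] [MonoidalCategory V] [RigidCategory V]
    [MonoidalPreadditive V] [MonoidalLinear k V] [IsFiniteTensor k V] [BraidedCategory V]
    -- the `V`-central finite tensor category `C`
    {C : Type*} [Category* C] [Abelian C] [Linear k C] [MonoidalCategory C] [RigidCategory C]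
    [MonoidalPreadditive C] [MonoidalLinear k C] [IsFiniteTensor k C]
    (G : V ⥤ Center C) [G.Braided] [G.Faithful]
    [(G ⋙ Center.forget C).Additive] [(G ⋙ Center.forget C).Linear k]
    [Limits.PreservesFiniteColimits (G ⋙ Center.forget C)]
    -- the `C`-module category `M`
    {M : Type*} [Category* M] [Abelian M] [Linear k M] [MonoidalLeftAction C M]
    [IsModuleCategory k C M] :
    -- internal Homs and the relative end exist
    (∀ m n : M, Nonempty (IHom C m n)) ∧
    ∀ H : ∀ m n : M, IHom C m n,
      Nonempty (RelativeEnd G H) ∧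
      ∀ A : RelativeEnd G H,
        -- the canonical half-braiding of `A`
        (∃! σ : HalfBraiding A.obj, A.IsCanonicalHalfBraiding σ) ∧
        ∀ σ : HalfBraiding A.obj, A.IsCanonicalHalfBraiding σ →
          -- `(A, e)` is a pair, and it is terminal
          (∃ (hc : IsRelCentral G (A.center σ))
            (hn : ∀ {m n : M} (f : m ⟶ n), (A.center σ).1 ⊴ₗ f ≫ A.e n = A.e m ≫ f)
            (hb : ∀ (X : C) (m : M),
              (αₗ (A.center σ).1 X m).hom ≫ A.e (X ⊙ₗ m) =
                ((A.center σ).2.β X).hom ⊵ₗ m ≫ (αₗ X (A.center σ).1 m).hom ≫ X ⊴ₗ A.e m),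
            Nonempty (Limits.IsTerminal
              (⟨A.center σ, hc, A.e, hn, hb⟩ : ActingPair G M))) ∧
          -- the canonical algebra structure of `A`
          (∃! mon : MonObj (A.center σ), A.IsCanonicalAlgebra σ mon) ∧
          ∀ mon : MonObj (A.center σ), A.IsCanonicalAlgebra σ mon →
            IsCommMonObj (A.center σ) ∧
            -- it is the algebra structure for which `e` makes every `m` an `A`-module
            (∀ m : M, (mon.mul.f : A.obj ⊗ A.obj ⟶ A.obj) ⊵ₗ m ≫ A.e m =
              (αₗ A.obj A.obj m).hom ≫ A.obj ⊴ₗ A.e m ≫ A.e m) ∧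
            (∀ m : M, (mon.one.f : 𝟙_ C ⟶ A.obj) ⊵ₗ m ≫ A.e m = (λₗ m).hom) ∧
            -- if `M` is the module category of right `B`-modules, then `A` is the
            -- Laugwitz–Walton algebra of `B`
            ∀ (B : C) [MonObj B] (Φ : M ⥤ RightMod B) [Φ.IsEquivalence] [Φ.LeftLinear C],
              ∃ ζ : (A.center σ).1 ⟶ B, IsLaugwitzWalton G B (A.center σ) ζ ∧
                ∀ (L : Center C) [MonObj L] (ζ' : L.1 ⟶ B), IsLaugwitzWalton G B L ζ' →
                  ∃ i : A.center σ ≅ L, IsMonHom i.hom ∧ i.hom.f ≫ ζ' = ζ := by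
  refine ⟨nonempty_iHom k, fun H => ⟨?_, fun A => ⟨A.existsUnique_isCanonicalHalfBraiding,
    fun σ hσ => ?_⟩⟩⟩
  · obtain ⟨A, e, hA⟩ := exists_isUniversal (k := k) G M
    exact ⟨hA.relativeEnd H⟩
  have hσ' := (A.isCanonicalHalfBraiding_iff σ).1 hσ
  have hc : IsRelCentral G (A.center σ) := A.isUniversal.isRelCentral (A := A.center σ) hσ'
  have hact := A.isActingFamily hσ
  have hu := fun P : ActingPair G M =>
    A.existsUnique_center hσ P.central (z := P.z) ⟨P.natural, P.compat⟩
  refine ⟨⟨hc, hact.natural, hact.compat, ⟨Limits.IsTerminal.ofUniqueHom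
    (fun P => ⟨(hu P).choose, (hu P).choose_spec.1⟩) fun P f =>
      ActingPair.Hom.ext ((hu P).unique f.comm (hu P).choose_spec.1)⟩⟩,
    A.existsUnique_isCanonicalAlgebra hσ, fun mon hmon => ?_⟩
  have hmul := fun m => (A.mul_comp_π_iff mon.mul.f m).1 (hmon.1 m)
  have hone := fun m => (A.one_comp_π_iff mon.one.f m).1 (hmon.2 m)
  refine ⟨A.isUniversal.isCommMonObj (A := A.center σ) hσ' ((A.isCanonicalAlgebra_iff σ mon).1 hmon),
    hmul, hone, fun B _ Φ _ _ => ?_⟩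
  obtain ⟨ζ, hr, hζ⟩ := hact.exists_relates (Φ := Φ)
  have hLW : IsLaugwitzWalton G B (A.center σ) ζ := isLaugwitzWalton_of_relates hc
    (fun Z z hZ hz => A.existsUnique_center hσ hZ hz) hmul hone hζ hr
  exact ⟨ζ, hLW, fun L _ ζ' h' => hLW.exists_iso h'⟩
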